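/- **Definitions.** A *discrete $n$-box* $\mathcal T=\{G,B_1,\dots,B_n,B_1',\dots,B_n'\}$ consists of a finite simplicial complex $K$ with 1-skeleton $G=(V,E)$ and subcomplexes $B_i,B_i'$ of $K$ such that some homeomorphism from the geometric realization $|K|$ onto $[0,1]^n$ carries $|B_i|$ onto $\{x_i=0\}$ and $|B_i'|$ onto $\{x_i=1\}$ for every $i$; $B_1,B_1'$ are the top and bottom faces. A *metric* is a function $m:V\to[0,\infty)$, its volume is $\|m\|_n=(\sum_{v\in V}m(v)^n)^{1/n}$, and its length $\ell_m$ is the minimum of $\sum_{v\in\gamma}m(v)$ over the vertex paths $\gamma$ in $G$ from a vertex of $B_1$ to a vertex of $B_1'$. The *extremal length* is $\mathrm{EL}(\mathcal T)=\sup\{\ell_m/\|m\|_n : \|m\|_n>0\}$, and a metric $m$ with $\|m\|_n>0$ is *extremal* if it attains this supremum. For a permutation $\sigma$ of $\{1,\dots,n\}$ let $\mathcal T^\sigma=\{G,B_{\sigma(1)},\dots,B_{\sigma(n)},B'_{\sigma(1)},\dots,B'_{\sigma(n)}\}$. Each of $B_i$ and $B_i'$ is itself a discrete $(n-1)$-box,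 whose pairs of opposing faces are its intersections with $B_j$ and with $B_j'$, for $j\ne i$. A *cube tiling* by $\mathcal T$ of $\mathcal U=[0,h_1]\times\cdots\times[0,h_n]$ (all $h_i>0$) is a family of axis-parallel cubes $C_v$, $v\in V$ (side length $0$, i.e. a point, is allowed) with $\bigcup_v C_v=\mathcal U$ such that two cubes of distinct vertices meet at most along their boundaries, $C_v\cap C_w\neq\varnothing$ whenever $v,w$ are adjacent in $G$, and $C_v$ meets $\{x_i=0\}$ whenever $v\in B_i$ and meets $\{x_i=h_i\}$ whenever $v\in B_i'$. **Theorem.** Let $n\ge 3$, let $\mathcal T$ be a discrete $n$-box with extremal metric $m$, and suppose that there is a cube tiling by $\mathcal T$ of a box $\mathcal U=[0,h_1]\times\cdots\times[0,h_n]$ of volume $h_1\cdots h_n=1$. Then: 1. For every $1\le i\le n$, $\mathrm{EL}(B_i)=\mathrm{EL}(B_i')$, where $B_i$ and $B_i'$ are considered as discrete $(n-1)$-boxes whose top and bottom faces are chosen consistently: for any $j\neq i$, the top and bottom faces are $B_i\cap B_j$, $B_i\cap B_j'$ and $B_i'\cap B_j$, $B_i'\cap B_j'$, respectively. 2. If for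 each $i$ a permutation $\sigma_i$ of $\{1,\dots,n\}$ with $\sigma_i(1)=i$ is given and $\mathcal T_i=\mathcal T^{\sigma_i}$, then $\mathrm{EL}(\mathcal T_1)\cdot\mathrm{EL}(\mathcal T_2)\cdots\mathrm{EL}(\mathcal T_n)=1$. 3. There are distinct vertices $v,w$ of $G$ with $m(v)=m(w)>0$. -/

import Mathlib

open scoped NNReal

/-- The geometric realization of a (finite) abstract simplicial complex, in barycentric
coordinates: the points of the simplices spanned by its faces. -/
def realization {V : Type*} (K : PreAbstractSimplicialComplex V) : Set (V → ℝ) :=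
  {x | ∃ s ∈ K.faces, (∀ v, v ∉ s → x v = 0) ∧ (∀ v, 0 ≤ x v) ∧ ∑ v ∈ s, x v = 1}

theorem realization_inf {V : Type*} (K L : PreAbstractSimplicialComplex V) :
    realization (K ⊓ L) = realization K ∩ realization L := by
  classical
  ext x
  constructor
  · rintro ⟨s, hs, hx⟩
    exact ⟨⟨s, hs.1, hx⟩, ⟨s, hs.2, hx⟩⟩
  · rintro ⟨⟨s, hs, hs0, hpos, hs1⟩, ⟨t, ht, ht0, -, -⟩⟩
    have hsum : ∑ v ∈ s ∩ t, x v = 1 := by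
      rw [← hs1]
      apply Finset.sum_subset Finset.inter_subset_left
      intro v hv hvn
      exact ht0 v fun hvt => hvn (Finset.mem_inter.2 ⟨hv, hvt⟩)
    have hne : (s ∩ t).Nonempty := by
      rw [Finset.nonempty_iff_ne_empty]
      intro h0
      rw [h0] at hsum
      simp at hsum
    refine ⟨s ∩ t, ⟨?_, ?_⟩, ?_, hpos, hsum⟩
    · exact (K.isRelLowerSet_faces hs).2 Finset.inter_subset_left hne
    · exact (L.isRelLowerSet_faces ht).2 Finset.inter_subset_right hne
    · intro v hv
      by_cases h : v ∈ s
      · exact ht0 v fun hvt => hv (Finset.mem_inter.2 ⟨h, hvt⟩)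
      · exact hs0 v h

theorem realization_mono {V : Type*} {K L : PreAbstractSimplicialComplex V} (h : K ≤ L) :
    realization K ⊆ realization L := by
  rintro x ⟨s, hs, hx⟩
  exact ⟨s, h hs, hx⟩

/-- A discrete `n`-box: a triangulation `complex` of the `n`-cube together with the
triangulations `B i`, `B' i` of its opposing faces. The homeomorphism of the realization onto
`[0,1]^n` carries (the realizations of) `B i` and `B' i` onto the faces `x i = 0` and `x i = 1`.
Vertices are elements of `V`; not every element of `V` has to be one. -/
structure DiscreteBox (V : Type*) (n : ℕ) where
  complex : PreAbstractSimplicialComplex V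
  B : Fin n → PreAbstractSimplicialComplex V
  B' : Fin n → PreAbstractSimplicialComplex V
  B_le : ∀ i, B i ≤ complex
  B'_le : ∀ i, B' i ≤ complex
  triangulates : ∃ φ : realization complex ≃ₜ Set.Icc (0 : Fin n → ℝ) 1,
    (∀ i (x : realization complex), (x : V → ℝ) ∈ realization (B i) ↔ (φ x : Fin n → ℝ) i = 0) ∧
    (∀ i (x : realization complex), (x : V → ℝ) ∈ realization (B' i) ↔ (φ x : Fin n → ℝ) i = 1)

/-- Permuting coordinates is a homeomorphism of the cube. -/
def cubePermute {n : ℕ} (σ : Equiv.Perm (Fin n)) :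
    Set.Icc (0 : Fin n → ℝ) 1 ≃ₜ Set.Icc (0 : Fin n → ℝ) 1 where
  toFun y := ⟨fun j => y.1 (σ j), fun j => y.2.1 (σ j), fun j => y.2.2 (σ j)⟩
  invFun y := ⟨fun j => y.1 (σ.symm j), fun j => y.2.1 (σ.symm j), fun j => y.2.2 (σ.symm j)⟩
  left_inv y := by ext j; simp
  right_inv y := by ext j; simp
  continuous_toFun := by
    refine Continuous.subtype_mk (continuous_pi fun j => ?_) _
    exact (continuous_apply (σ j)).comp continuous_subtype_val
  continuous_invFun := by
    refine Continuous.subtype_mk (continuous_pi fun j => ?_) _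
    exact (continuous_apply (σ.symm j)).comp continuous_subtype_val

/-- If the face `x i = c` of the `(n+1)`-cube corresponds to the subcomplex `L` of `K`, then
the realization of `L` is homeomorphic to the `n`-cube by deleting the `i`-th coordinate. -/
def faceHomeo {V : Type*} {n : ℕ} {K L : PreAbstractSimplicialComplex V} (hL : L ≤ K)
    (φ : realization K ≃ₜ Set.Icc (0 : Fin (n + 1) → ℝ) 1) (i : Fin (n + 1)) (c : ℝ)
    (hc : c ∈ Set.Icc (0 : ℝ) 1)
    (hφ : ∀ x : realization K, (x : V → ℝ) ∈ realization L ↔ (φ x : Fin (n + 1) → ℝ) i = c) :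
    realization L ≃ₜ Set.Icc (0 : Fin n → ℝ) 1 where
  toFun x := ⟨fun j => (φ ⟨x.1, realization_mono hL x.2⟩).1 (i.succAbove j),
    fun j => (φ ⟨x.1, realization_mono hL x.2⟩).2.1 (i.succAbove j),
    fun j => (φ ⟨x.1, realization_mono hL x.2⟩).2.2 (i.succAbove j)⟩
  invFun y := ⟨(φ.symm ⟨i.insertNth c y.1,
      (Fin.insertNth_mem_Icc (α := fun _ => ℝ)).2 ⟨hc, y.2⟩⟩).1, by
    rw [hφ]; simp⟩
  left_inv x := by
    have h := (hφ ⟨x.1, realization_mono hL x.2⟩).1 x.2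
    apply Subtype.ext
    have : (⟨i.insertNth c fun j => (φ ⟨x.1, realization_mono hL x.2⟩).1 (i.succAbove j),
        (Fin.insertNth_mem_Icc (α := fun _ => ℝ)).2 ⟨hc,
          fun j => (φ ⟨x.1, realization_mono hL x.2⟩).2.1 (i.succAbove j),
          fun j => (φ ⟨x.1, realization_mono hL x.2⟩).2.2 (i.succAbove j)⟩⟩ :
        Set.Icc (0 : Fin (n + 1) → ℝ) 1) = φ ⟨x.1, realization_mono hL x.2⟩ := by
      apply Subtype.ext
      funext k
      rcases Fin.eq_self_or_eq_succAbove i k with rfl | ⟨j, rfl⟩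
      · simpa using h.symm
      · simp
    simp [this]
  right_inv y := by
    ext j
    simp
  continuous_toFun := by
    refine Continuous.subtype_mk (continuous_pi fun j => ?_) _
    exact (continuous_apply (i.succAbove j)).comp (continuous_subtype_val.comp
      (φ.continuous.comp (Continuous.subtype_mk continuous_subtype_val _)))
  continuous_invFun := by
    refine Continuous.subtype_mk ?_ _
    refine continuous_subtype_val.comp (φ.symm.continuous.comp (Continuous.subtype_mk ?_ _))
    exact Continuous.finInsertNth i continuous_const continuous_subtype_val

namespace DiscreteBox

/-- The discrete box with its pairs of opposing faces renumbered by `σ`. -/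
def permute {V : Type*} {n : ℕ} (T : DiscreteBox V n) (σ : Equiv.Perm (Fin n)) :
    DiscreteBox V n where
  complex := T.complex
  B i := T.B (σ i)
  B' i := T.B' (σ i)
  B_le i := T.B_le (σ i)
  B'_le i := T.B'_le (σ i)
  triangulates := by
    obtain ⟨φ, h, h'⟩ := T.triangulates
    exact ⟨φ.trans (cubePermute σ), fun i x => h (σ i) x, fun i x => h' (σ i) x⟩

/-- The face `B i` as a discrete box of one dimension less. Its opposing faces are the
intersections of `B i` with `B j` and `B' j` for the `j ≠ i`, in increasing order of `j`. -/
def face {V : Type*} {n : ℕ} (T : DiscreteBox V (n + 1)) (i : Fin (n + 1)) :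
    DiscreteBox V n where
  complex := T.B i
  B j := T.B i ⊓ T.B (i.succAbove j)
  B' j := T.B i ⊓ T.B' (i.succAbove j)
  B_le _ := Set.inter_subset_left
  B'_le _ := Set.inter_subset_left
  triangulates := by
    obtain ⟨φ, h, h'⟩ := T.triangulates
    refine ⟨faceHomeo (T.B_le i) φ i 0 (by simp) (h i), fun j x => ?_, fun j x => ?_⟩
    · rw [realization_inf]
      exact ⟨fun hx => (h _ ⟨x.1, realization_mono (T.B_le i) x.2⟩).1 hx.2,
        fun hx => ⟨x.2, (h _ ⟨x.1, realization_mono (T.B_le i) x.2⟩).2 hx⟩⟩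
    · rw [realization_inf]
      exact ⟨fun hx => (h' _ ⟨x.1, realization_mono (T.B_le i) x.2⟩).1 hx.2,
        fun hx => ⟨x.2, (h' _ ⟨x.1, realization_mono (T.B_le i) x.2⟩).2 hx⟩⟩

/-- The face `B' i` as a discrete box of one dimension less, its opposing faces numbered
in the same way as those of `B i`. -/
def face' {V : Type*} {n : ℕ} (T : DiscreteBox V (n + 1)) (i : Fin (n + 1)) :
    DiscreteBox V n where
  complex := T.B' i
  B j := T.B' i ⊓ T.B (i.succAbove j)
  B' j := T.B' i ⊓ T.B' (i.succAbove j)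
  B_le _ := Set.inter_subset_left
  B'_le _ := Set.inter_subset_left
  triangulates := by
    obtain ⟨φ, h, h'⟩ := T.triangulates
    refine ⟨faceHomeo (T.B'_le i) φ i 1 (by simp) (h' i), fun j x => ?_, fun j x => ?_⟩
    · rw [realization_inf]
      exact ⟨fun hx => (h _ ⟨x.1, realization_mono (T.B'_le i) x.2⟩).1 hx.2,
        fun hx => ⟨x.2, (h _ ⟨x.1, realization_mono (T.B'_le i) x.2⟩).2 hx⟩⟩
    · rw [realization_inf]
      exact ⟨fun hx => (h' _ ⟨x.1, realization_mono (T.B'_le i) x.2⟩).1 hx.2,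
        fun hx => ⟨x.2, (h' _ ⟨x.1, realization_mono (T.B'_le i) x.2⟩).2 hx⟩⟩

/-- The vertices of the triangulation. -/
abbrev Vertex {V : Type*} {n : ℕ} (T : DiscreteBox V n) : Type _ :=
  {v : V // {v} ∈ T.complex.faces}

noncomputable instance {V : Type*} [Finite V] {n : ℕ} (T : DiscreteBox V n) :
    Fintype T.Vertex := Fintype.ofFinite _

/-- The 1-skeleton of the triangulation. -/
def graph {V : Type*} {n : ℕ} (T : DiscreteBox V n) : SimpleGraph T.Vertex where
  Adj v w := v ≠ w ∧ ∃ s ∈ T.complex.faces, v.1 ∈ s ∧ w.1 ∈ s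
  symm := ⟨fun _ _ h => ⟨h.1.symm, h.2.imp fun _ hs => ⟨hs.1, hs.2.2, hs.2.1⟩⟩⟩
  loopless := ⟨fun _ h => h.1 rfl⟩

/-- The volume `(∑ m(v)^n)^(1/n)` of a metric. -/
noncomputable def volume {V : Type*} [Finite V] {n : ℕ} (T : DiscreteBox V n)
    (m : T.Vertex → ℝ≥0) : ℝ :=
  (∑ v, (m v : ℝ) ^ n) ^ ((1 : ℝ) / n)

/-- The `m`-lengths of the vertex paths from the top face to the bottom face. -/
def pathLengths {V : Type*} {n : ℕ} [NeZero n] (T : DiscreteBox V n)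
    (m : T.Vertex → ℝ≥0) : Set ℝ :=
  {L | ∃ v w : T.Vertex, {v.1} ∈ (T.B 0).faces ∧ {w.1} ∈ (T.B' 0).faces ∧
    ∃ γ : T.graph.Path v w, L = (γ.1.support.map fun u => (m u : ℝ)).sum}

/-- The length of a metric. -/
noncomputable def length {V : Type*} {n : ℕ} [NeZero n] (T : DiscreteBox V n)
    (m : T.Vertex → ℝ≥0) : ℝ :=
  sInf (T.pathLengths m)

/-- The normalized length of a metric. -/
noncomputable def normalizedLength {V : Type*} [Finite V] {n : ℕ} [NeZero n]
    (T : DiscreteBox V n) (m : T.Vertex → ℝ≥0) : ℝ :=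
  T.length m / T.volume m

/-- The extremal length of a discrete box: the supremum of the normalized lengths of
the metrics of positive volume. -/
noncomputable def EL {V : Type*} [Finite V] {n : ℕ} [NeZero n] (T : DiscreteBox V n) : ℝ :=
  sSup (T.normalizedLength '' {m | 0 < T.volume m})

/-- A metric is extremal if it has positive volume and realizes the extremal length. -/
def IsExtremal {V : Type*} [Finite V] {n : ℕ} [NeZero n] (T : DiscreteBox V n)
    (m : T.Vertex → ℝ≥0) : Prop :=
  0 < T.volume m ∧ T.normalizedLength m = T.EL

end DiscreteBox

/-- The axis-parallel cube with lowest corner `a` and side length `r`;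
for `r = 0` it is the point `a`. -/
def axisCube {n : ℕ} (a : Fin n → ℝ) (r : ℝ≥0) : Set (Fin n → ℝ) :=
  Set.Icc a (fun i => a i + r)

/-- A cube tiling of the geometric box `[0, h 0] × ⋯ × [0, h (n-1)]` by the discrete box `T`:
the cubes cover the box and nothing else, meet one another only along their boundaries,
adjacent vertices have intersecting cubes, and the cubes of the vertices of `B i` and of `B' i`
meet the faces `x i = 0` and `x i = h i` of the geometric box. Null-weight vertices
(cubes that are single points) are allowed. -/
structure CubeTiling {V : Type*} {n : ℕ} (T : DiscreteBox V n) (h : Fin n → ℝ) where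
  corner : T.Vertex → Fin n → ℝ
  side : T.Vertex → ℝ≥0
  cover : ⋃ v, axisCube (corner v) (side v) = Set.Icc 0 h
  inter_subset : ∀ v w, v ≠ w → axisCube (corner v) (side v) ∩ axisCube (corner w) (side w) ⊆
    frontier (axisCube (corner v) (side v)) ∩ frontier (axisCube (corner w) (side w))
  adj : ∀ v w, T.graph.Adj v w →
    (axisCube (corner v) (side v) ∩ axisCube (corner w) (side w)).Nonempty
  meets : ∀ i (v : T.Vertex), {v.1} ∈ (T.B i).faces →
    ∃ x ∈ axisCube (corner v) (side v), x i = 0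
  meets' : ∀ i (v : T.Vertex), {v.1} ∈ (T.B' i).faces →
    ∃ x ∈ axisCube (corner v) (side v), x i = h i

/-! The tiling computes the extremal length, and the key is topological. For a line in direction `i`
through the geometric box, the vertices whose cubes meet it contain a path of `T.graph` from `B i`
to `B' i` (`exists_path_lineVertices`). Otherwise a sign labelling of the triangulation would extend
to a map of the cube with no zero, against the Poincaré–Miranda theorem, which is proved here by a
mod 2 degree on grids.

Hence the length of a metric `m` is at most the sum of `m` over the cubes met by any line in
direction `0`. Integrating this over the box and applying Hölder's inequality bounds the normalized
length by `h 0 / (∏ h i)^(1/n)`. The side lengths attain the bound, because touching cubes along a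
path must cover the distance `h 0` and their total volume is at most `∏ h i`. So `EL_eq` gives the
extremal length, and equality in Hölder makes every extremal metric proportional to the side lengths
when the dimension is at least two.

None of this needs the cubes to cover the box, only that they do not overlap. A `CubePacking`
restricts to the faces, and the packings of `B i` and `B' i` have the same side lengths `h j`, which
gives claim 1. With volume one, the extremal length in direction `i` is `h i`, which gives claim 2.

For claim 3 the covering matters: no box of dimension at least three is tiled by finitely many cubes
of distinct sizes (`false_of_lt`). The smallest cube standing on a valley floor is walled in by
larger neighbours, so its top is again a valley, and the descent never ends. -/

/-! ### Mod 2 degree on a grid and the Poincaré–Miranda theorem. -/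

/-- The `t`-th vertex of the monotone lattice path from `z` that performs the unit step in the
`i`-th coordinate at time `ρ i`. -/
def latticePath {n : ℕ} (ρ : Equiv.Perm (Fin n)) (z : Fin n → ℕ) (t : ℕ) : Fin n → ℕ :=
  fun i => z i + if (ρ i : ℕ) < t then 1 else 0

/-- The cup product of the coboundaries of `u 0, …, u (n-1)` along a lattice path. -/
def cupAlong {n : ℕ} (u : Fin n → (Fin n → ℕ) → ZMod 2) (ρ : Equiv.Perm (Fin n))
    (z : Fin n → ℕ) : ZMod 2 :=
  ∏ j : Fin n, (u j (latticePath ρ z (j + 1)) - u j (latticePath ρ z j))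

/-- The lattice path that skips the step at time `0`. -/
def latticePathSkip {n : ℕ} (ρ : Equiv.Perm (Fin n)) (z : Fin n → ℕ) (t : ℕ) : Fin n → ℕ :=
  fun i => z i + if 0 < (ρ i : ℕ) ∧ (ρ i : ℕ) < t then 1 else 0

/-- The cochain `u 0 ∪ δ(u 1) ∪ ⋯ ∪ δ(u n)` along the path that skips its step at time `0`. -/
def cupSkip {n : ℕ} (u : Fin (n + 1) → (Fin (n + 1) → ℕ) → ZMod 2)
    (ρ : Equiv.Perm (Fin (n + 1))) (z : Fin (n + 1) → ℕ) : ZMod 2 :=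
  u 0 (latticePathSkip ρ z 1) * ∏ j : Fin n,
    (u j.succ (latticePathSkip ρ z (j + 2)) - u j.succ (latticePathSkip ρ z (j + 1)))

theorem latticePath_swap {n : ℕ} (ρ : Equiv.Perm (Fin (n + 1))) (z : Fin (n + 1) → ℕ) (k : Fin n)
    {t : ℕ} (ht : t ≠ k + 1) :
    latticePath (Equiv.swap k.castSucc k.succ * ρ) z t = latticePath ρ z t := by
  funext i
  have : ((Equiv.swap k.castSucc k.succ (ρ i) : Fin (n + 1)) : ℕ) < t ↔ (ρ i : ℕ) < t := by
    rcases eq_or_ne (ρ i) k.castSucc with h | h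
    · rw [h, Equiv.swap_apply_left]
      simp only [Fin.val_succ, Fin.val_castSucc]
      omega
    · rcases eq_or_ne (ρ i) k.succ with h' | h'
      · rw [h', Equiv.swap_apply_right]
        simp only [Fin.val_succ, Fin.val_castSucc]
        omega
      · rw [Equiv.swap_apply_of_ne_of_ne h h']
  simp [latticePath, this]

/-- Deleting an interior vertex of all lattice paths gives a sum that cancels modulo 2. -/
theorem sum_perm_eq_zero {n : ℕ} (k : Fin n) (E : Equiv.Perm (Fin (n + 1)) → ZMod 2)
    (hE : ∀ ρ, E (Equiv.swap k.castSucc k.succ * ρ) = E ρ) : ∑ ρ, E ρ = 0 := by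
  refine Finset.sum_involution (fun ρ _ => Equiv.swap k.castSucc k.succ * ρ) ?_ ?_ ?_ ?_
  · intro ρ _
    rw [hE]
    exact CharTwo.add_self_eq_zero _
  · intro ρ _ _ h
    have : Equiv.swap k.castSucc k.succ = 1 := by simpa using h
    rw [Equiv.swap_eq_one_iff] at this
    exact absurd this (Fin.castSucc_lt_succ).ne
  · simp
  · intro ρ _
    simp [← mul_assoc]

/-- Interpolates between the cochains that delete the first and the last vertex. -/
def cupMixed {n : ℕ} (u : Fin (n + 1) → (Fin (n + 1) → ℕ) → ZMod 2)
    (z : Fin (n + 1) → ℕ) (t : ℕ) (ρ : Equiv.Perm (Fin (n + 1))) : ZMod 2 :=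
  u 0 (latticePath ρ z 0) * ∏ j : Fin n,
    if (j : ℕ) < t then u j.succ (latticePath ρ z (j + 1)) - u j.succ (latticePath ρ z j)
    else u j.succ (latticePath ρ z (j + 2)) - u j.succ (latticePath ρ z (j + 1))

/-- The two products differ only in factor `k`, and adding them joins two consecutive steps into one
that jumps over vertex `k + 1`. Swapping the directions of these two steps changes only that vertex,
so the permutations cancel in pairs. -/
theorem sum_cupMixed_succ {n : ℕ} (u : Fin (n + 1) → (Fin (n + 1) → ℕ) → ZMod 2)
    (z : Fin (n + 1) → ℕ) (k : Fin n) :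
    ∑ ρ, cupMixed u z k ρ = ∑ ρ, cupMixed u z (k + 1) ρ := by
  rw [← sub_eq_zero, CharTwo.sub_eq_add, ← Finset.sum_add_distrib]
  let E : Equiv.Perm (Fin (n + 1)) → ZMod 2 := fun ρ =>
    u 0 (latticePath ρ z 0) * ∏ j : Fin n,
      if j = k then u j.succ (latticePath ρ z (j + 2)) - u j.succ (latticePath ρ z j)
      else if (j : ℕ) < k then u j.succ (latticePath ρ z (j + 1)) - u j.succ (latticePath ρ z j)
      else u j.succ (latticePath ρ z (j + 2)) - u j.succ (latticePath ρ z (j + 1))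
  have hE : ∀ ρ, cupMixed u z k ρ + cupMixed u z (k + 1) ρ = E ρ := by
    intro ρ
    simp only [cupMixed, E, ← mul_add]
    congr 1
    refine Finset.prod_add_prod_eq (Finset.mem_univ k) ?_ ?_ ?_
    · simp
    · intro j _ hj
      simp [hj]
    · intro j _ hj
      have : (j : ℕ) ≠ k := fun h => hj (Fin.ext h)
      simp only [hj, if_false]
      congr 1
      simp only [eq_iff_iff]
      omega
  simp only [hE]
  refine sum_perm_eq_zero k E fun ρ => ?_
  simp only [E]
  rw [latticePath_swap ρ z k (by omega)]
  congr 1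
  refine Finset.prod_congr rfl fun j _ => ?_
  split_ifs with h1 h2
  · subst h1
    rw [latticePath_swap ρ z j (by omega), latticePath_swap ρ z j (by omega)]
  · rw [latticePath_swap ρ z k (by omega), latticePath_swap ρ z k (by omega)]
  · have : (j : ℕ) ≠ k := fun h => h1 (Fin.ext h)
    rw [latticePath_swap ρ z k (by omega), latticePath_swap ρ z k (by omega)]

theorem sum_cupMixed_zero {n : ℕ} (u : Fin (n + 1) → (Fin (n + 1) → ℕ) → ZMod 2)
    (z : Fin (n + 1) → ℕ) :
    ∑ ρ, cupMixed u z 0 ρ = ∑ ρ, cupMixed u z n ρ := by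
  have : ∀ t ≤ n, ∑ ρ, cupMixed u z 0 ρ = ∑ ρ, cupMixed u z t ρ := by
    intro t
    induction t with
    | zero => intro _; rfl
    | succ t ih =>
      intro ht
      rw [ih (by omega)]
      exact sum_cupMixed_succ u z ⟨t, by omega⟩
  exact this n le_rfl

theorem latticePath_eq_skip_add {n : ℕ} (ρ : Equiv.Perm (Fin (n + 1))) (z : Fin (n + 1) → ℕ)
    (t : ℕ) :
    latticePath ρ z (t + 1) = latticePathSkip ρ (z + Pi.single (ρ.symm 0) 1) (t + 1) := by
  funext i
  simp only [latticePath, latticePathSkip, Pi.add_apply]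
  rcases eq_or_ne i (ρ.symm 0) with rfl | h
  · simp
  · have h' : ρ i ≠ 0 := fun h0 => h (by rw [← h0]; simp)
    have h'' : 0 < (ρ i : ℕ) := Nat.pos_of_ne_zero fun h0 => h' (Fin.ext h0)
    simp [h, h'']

/-- Dropping the last step of a path amounts to dropping the first step after a cyclic shift of the
times; this brings both ends of the cell to the form `cupSkip`. -/
theorem latticePath_rotate {n : ℕ} (ρ : Equiv.Perm (Fin (n + 1))) (z : Fin (n + 1) → ℕ)
    {t : ℕ} (ht : t ≤ n) :
    latticePath ((finRotate (n + 1)).symm * ρ) z t = latticePathSkip ρ z (t + 1) := by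
  funext i
  have : (((finRotate (n + 1)).symm (ρ i) : Fin (n + 1)) : ℕ) < t ↔
      0 < (ρ i : ℕ) ∧ (ρ i : ℕ) < t + 1 := by
    rcases eq_or_ne (ρ i) 0 with h | h
    · have : (finRotate (n + 1)).symm 0 = Fin.last n := by
        rw [Equiv.symm_apply_eq, finRotate_last]
      simp [h, this, ht]
    · rw [coe_finRotate_symm_of_ne_zero h]
      have : 0 < (ρ i : ℕ) := Nat.pos_of_ne_zero fun h0 => h (Fin.ext h0)
      omega
  simp only [latticePath, latticePathSkip, Equiv.Perm.mul_apply, this]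

/-- Discrete Stokes formula for one cell. -/
theorem sum_cupAlong_eq {n : ℕ} (u : Fin (n + 1) → (Fin (n + 1) → ℕ) → ZMod 2)
    (z : Fin (n + 1) → ℕ) :
    ∑ ρ, cupAlong u ρ z =
      ∑ ρ, (cupSkip u ρ (z + Pi.single (ρ.symm 0) 1) - cupSkip u ρ z) := by
  -- The factor of `u 0` is a difference of values at vertices 1 and 0. The first lives on the
  -- translated face of the cell, the second is the mixed cochain at time 0, which is then moved to
  -- time `n`.
  have h1 : ∀ ρ, cupAlong u ρ z =
      cupSkip u ρ (z + Pi.single (ρ.symm 0) 1) - cupMixed u z 0 ρ := by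
    intro ρ
    simp only [cupAlong, cupSkip, cupMixed, Fin.prod_univ_succ, Nat.not_lt_zero, if_false,
      Fin.val_zero, Fin.val_succ, ← latticePath_eq_skip_add]
    rw [← sub_mul]
  simp only [h1, Finset.sum_sub_distrib, sum_cupMixed_zero]
  congr 1
  rw [← Equiv.sum_comp (Equiv.mulLeft (finRotate (n + 1)).symm)]
  refine Finset.sum_congr rfl fun ρ _ => ?_
  simp only [Equiv.coe_mulLeft, cupMixed, cupSkip]
  rw [latticePath_rotate ρ z (Nat.zero_le _)]
  congr 1
  refine Finset.prod_congr rfl fun j _ => ?_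
  rw [if_pos j.2, latticePath_rotate ρ z (by omega), latticePath_rotate ρ z (by omega)]

theorem sum_telescope {n k : ℕ} (c : Fin (n + 1)) (G : (Fin (n + 1) → ℕ) → ZMod 2) :
    ∑ z : Fin (n + 1) → Fin k,
        (G ((fun i => (z i : ℕ)) + Pi.single c 1) - G (fun i => (z i : ℕ))) =
      ∑ w : Fin n → Fin k, (G (c.insertNth (α := fun _ => ℕ) k fun i => (w i : ℕ)) -
        G (c.insertNth (α := fun _ => ℕ) 0 fun i => (w i : ℕ))) := by
  rw [← (Fin.insertNthEquiv (fun _ => Fin k) c).sum_comp, Fintype.sum_prod_type_right]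
  refine Finset.sum_congr rfl fun w _ => ?_
  let g : ℕ → ZMod 2 := fun a => G (c.insertNth (α := fun _ => ℕ) a fun i => (w i : ℕ))
  have h : ∀ a : Fin k, (fun i => (((Fin.insertNthEquiv (fun _ => Fin k) c) (a, w)) i : ℕ)) =
      c.insertNth (α := fun _ => ℕ) (a : ℕ) fun i => (w i : ℕ) := by
    intro a
    funext i
    rcases Fin.eq_self_or_eq_succAbove c i with rfl | ⟨j, rfl⟩ <;> simp [Fin.insertNthEquiv]
  have h' : ∀ a : Fin k,
      (c.insertNth (α := fun _ => ℕ) (a : ℕ) fun i => (w i : ℕ)) + Pi.single c 1 =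
      c.insertNth (α := fun _ => ℕ) ((a : ℕ) + 1) fun i => (w i : ℕ) := by
    intro a
    funext i
    rcases Fin.eq_self_or_eq_succAbove c i with rfl | ⟨j, rfl⟩ <;> simp
  simp only [h, h']
  rw [Fin.sum_univ_eq_sum_range (fun a => g (a + 1) - g a), Finset.sum_range_sub]

/-- The step in coordinate `c.succ` is the skipped one, so the path never leaves the hyperplane on
which `u c.succ` is constant, and factor `c` vanishes. -/
theorem cupSkip_of_const {n : ℕ} {u : Fin (n + 1) → (Fin (n + 1) → ℕ) → ZMod 2}
    {ρ : Equiv.Perm (Fin (n + 1))} {c : Fin n} (hc : ρ c.succ = 0) {z : Fin (n + 1) → ℕ}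
    {b : ZMod 2} (hu : ∀ w, w c.succ = z c.succ → u c.succ w = b) : cupSkip u ρ z = 0 := by
  rw [cupSkip, Finset.prod_eq_zero (Finset.mem_univ c), mul_zero]
  rw [hu _ (by simp [latticePathSkip, hc]), hu _ (by simp [latticePathSkip, hc]), sub_self]

/-- The mod 2 degree of a labelling of the grid `{0,…,k}^n` that has the labels of the identity
on the boundary is `1`. -/
theorem sum_cupAlong_eq_one (n k : ℕ) (u : Fin n → (Fin n → ℕ) → ZMod 2)
    (h0 : ∀ j z, z j = 0 → u j z = 0) (h1 : ∀ j z, z j = k → u j z = 1) :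
    ∑ z : Fin n → Fin k, ∑ ρ, cupAlong u ρ (fun i => (z i : ℕ)) = 1 := by
  induction n with
  | zero => simp [cupAlong]
  | succ n ih =>
    simp only [sum_cupAlong_eq]
    rw [Finset.sum_comm]
    simp only [sum_telescope]
    -- Only the faces orthogonal to coordinate 0 contribute. There `u 0` is 0 on one side and 1 on
    -- the other, which leaves the degree sum in one dimension less.
    rw [← Equiv.Perm.decomposeFin.symm.sum_comp, Fintype.sum_prod_type,
      Finset.sum_eq_single (0 : Fin (n + 1)) _ (by simp)]
    · rw [← ih (fun j w => u j.succ (Fin.cons k w)) (fun j w hw => h0 _ _ (by simpa using hw))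
        (fun j w hw => h1 _ _ (by simpa using hw)), Finset.sum_comm]
      refine Finset.sum_congr rfl fun w _ => Finset.sum_congr rfl fun e _ => ?_
      have hc : (Equiv.Perm.decomposeFin.symm ((0 : Fin (n + 1)), e)).symm 0 = 0 := by
        rw [Equiv.symm_apply_eq]; simp
      rw [hc, Fin.insertNth_zero', Fin.insertNth_zero']
      have hz : cupSkip u (Equiv.Perm.decomposeFin.symm (0, e))
          (Fin.cons 0 fun i => (w i : ℕ)) = 0 := by
        rw [cupSkip, h0 0 _ (by simp [latticePathSkip]), zero_mul]
      rw [hz, sub_zero, cupSkip, h1 0 _ (by simp [latticePathSkip]), one_mul]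
      have hp : ∀ t : ℕ, latticePathSkip (Equiv.Perm.decomposeFin.symm (0, e))
          (Fin.cons k fun i => (w i : ℕ)) (t + 1) =
          Fin.cons k (latticePath e (fun i => (w i : ℕ)) t) := by
        intro t
        funext i
        refine Fin.cases ?_ (fun i => ?_) i <;> simp [latticePathSkip, latticePath]
      refine Finset.prod_congr rfl fun j _ => ?_
      simp only [hp]
    · intro b _ hb
      refine Finset.sum_eq_zero fun e _ => Finset.sum_eq_zero fun w _ => ?_
      set ρ := Equiv.Perm.decomposeFin.symm (b, e) with hρ
      have hc : ρ.symm 0 ≠ 0 := by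
        intro h
        rw [Equiv.symm_apply_eq, hρ, Equiv.Perm.decomposeFin_symm_apply_zero] at h
        exact hb h.symm
      obtain ⟨c, hc⟩ := Fin.exists_succ_eq.2 hc
      have hρc : ρ c.succ = 0 := by rw [hc]; simp
      rw [← hc, cupSkip_of_const hρc (b := 1) (fun v hv => h1 _ _ (by simpa using hv)),
        cupSkip_of_const hρc (b := 0) (fun v hv => h0 _ _ (by simpa using hv)), sub_zero]

/-- Since the degree is nonzero, some cell has a lattice path along which every label `j` flips at
its `j`-th step. All vertices of the path lie within one mesh width of the base corner. -/
theorem exists_small_sign_changes {n : ℕ} {F : (Fin n → ℝ) → Fin n → ℝ}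
    (h0 : ∀ x ∈ Set.Icc (0 : Fin n → ℝ) 1, ∀ j, x j = 0 → F x j ≤ 0)
    (h1 : ∀ x ∈ Set.Icc (0 : Fin n → ℝ) 1, ∀ j, x j = 1 → 0 ≤ F x j) (k : ℕ) :
    ∃ x ∈ Set.Icc (0 : Fin n → ℝ) 1, ∀ j, ∃ a ∈ Set.Icc (0 : Fin n → ℝ) 1,
      ∃ b ∈ Set.Icc (0 : Fin n → ℝ) 1, dist a x ≤ 1 / ((k : ℝ) + 1) ∧
        dist b x ≤ 1 / ((k : ℝ) + 1) ∧ F a j ≤ 0 ∧ 0 ≤ F b j := by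
  classical
  have hk : (0 : ℝ) < (k : ℝ) + 1 := by positivity
  let pt : (Fin n → ℕ) → Fin n → ℝ := fun z i => (z i : ℝ) / ((k : ℝ) + 1)
  -- The boundary labels are prescribed rather than read off from `F`, since `F` may vanish there;
  -- the weak inequalities `h0` and `h1` keep them compatible with its signs.
  let u : Fin n → (Fin n → ℕ) → ZMod 2 := fun j z =>
    if z j = 0 then 0 else if z j = k + 1 then 1 else if 0 < F (pt z) j then 1 else 0
  have hsum := sum_cupAlong_eq_one n (k + 1) u (fun j z hz => by simp [u, hz])
    (fun j z hz => by simp [u, hz])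
  obtain ⟨z, -, hz⟩ := Finset.exists_ne_zero_of_sum_ne_zero (hsum.trans_ne one_ne_zero)
  obtain ⟨ρ, -, hρ⟩ := Finset.exists_ne_zero_of_sum_ne_zero hz
  have hpt : ∀ w : Fin n → ℕ, (∀ i, w i ≤ k + 1) → pt w ∈ Set.Icc (0 : Fin n → ℝ) 1 := by
    intro w hw
    refine ⟨fun i => by simp only [pt]; positivity, fun i => ?_⟩
    simp only [pt, Pi.one_apply]
    rw [div_le_one hk]
    exact_mod_cast hw i
  have hu0 : ∀ j w, (∀ i, w i ≤ k + 1) → u j w = 0 → F (pt w) j ≤ 0 := by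
    intro j w hw h
    simp only [u] at h
    split_ifs at h with h2 h3 h4
    · exact h0 _ (hpt w hw) j (by simp [pt, h2])
    · exact absurd h one_ne_zero
    · exact absurd h one_ne_zero
    · exact not_lt.1 h4
  have hu1 : ∀ j w, (∀ i, w i ≤ k + 1) → u j w ≠ 0 → 0 ≤ F (pt w) j := by
    intro j w hw h
    simp only [u] at h
    split_ifs at h with h2 h3 h4
    · exact absurd rfl h
    · exact h1 _ (hpt w hw) j (by simp [pt, h3, hk.ne'])
    · exact h4.le
    · exact absurd rfl h
  let p : ℕ → Fin n → ℕ := latticePath ρ fun i => (z i : ℕ)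
  have hp : ∀ t i, p t i ≤ k + 1 := by
    intro t i
    have := (z i).2
    simp only [p, latticePath]
    split_ifs <;> omega
  have hd : ∀ t, dist (pt (p t)) (pt fun i => (z i : ℕ)) ≤ 1 / ((k : ℝ) + 1) := by
    intro t
    refine (dist_pi_le_iff (by positivity)).2 fun i => ?_
    simp only [pt, p, latticePath, Real.dist_eq, ← sub_div, abs_div, abs_of_pos hk]
    gcongr
    split_ifs <;> simp
  refine ⟨pt fun i => (z i : ℕ), hpt _ fun i => (z i).2.le, fun j => ?_⟩
  have hj : u j (p (j + 1)) - u j (p j) ≠ 0 := fun h =>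
    hρ (Finset.prod_eq_zero (Finset.mem_univ j) h)
  by_cases h : u j (p j) = 0
  · exact ⟨_, hpt _ (hp j), _, hpt _ (hp (j + 1)), hd _, hd _, hu0 j _ (hp j) h,
      hu1 j _ (hp _) (by simpa [h] using hj)⟩
  · have h' : u j (p (j + 1)) = 0 := by
      generalize u j (p (j + 1)) = x at hj ⊢
      generalize u j (p j) = y at hj h
      revert x y
      decide
    exact ⟨_, hpt _ (hp (j + 1)), _, hpt _ (hp j), hd _, hd _, hu0 j _ (hp _) h',
      hu1 j _ (hp _) h⟩

/-- The Poincaré–Miranda theorem. -/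
theorem poincare_miranda {n : ℕ} {F : (Fin n → ℝ) → Fin n → ℝ}
    (hF : ContinuousOn F (Set.Icc 0 1))
    (h0 : ∀ x ∈ Set.Icc (0 : Fin n → ℝ) 1, ∀ j, x j = 0 → F x j ≤ 0)
    (h1 : ∀ x ∈ Set.Icc (0 : Fin n → ℝ) 1, ∀ j, x j = 1 → 0 ≤ F x j) :
    ∃ x ∈ Set.Icc (0 : Fin n → ℝ) 1, F x = 0 := by
  choose x hx a ha b hb hax hbx hFa hFb using exists_small_sign_changes h0 h1
  obtain ⟨y, hy, φ, hφ, hlim⟩ := (isCompact_Icc (a := (0 : Fin n → ℝ)) (b := 1)).tendsto_subseq hx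
  refine ⟨y, hy, ?_⟩
  have key : ∀ c : ℕ → Fin n → ℝ, (∀ k, c k ∈ Set.Icc (0 : Fin n → ℝ) 1) →
      (∀ k, dist (c k) (x k) ≤ 1 / ((k : ℝ) + 1)) →
      Filter.Tendsto (fun k => F (c (φ k))) Filter.atTop (nhds (F y)) := by
    intro c hc hcx
    have hd : Filter.Tendsto (fun k => dist (x (φ k)) (c (φ k))) Filter.atTop (nhds 0) := by
      refine squeeze_zero (fun _ => dist_nonneg) (fun k => ?_)
        (tendsto_one_div_add_atTop_nhds_zero_nat.comp hφ.tendsto_atTop)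
      rw [dist_comm]
      exact hcx _
    have hcy : Filter.Tendsto (fun k => c (φ k)) Filter.atTop (nhds y) :=
      (tendsto_iff_of_dist hd).1 hlim
    exact (hF y hy).tendsto.comp
      (tendsto_nhdsWithin_iff.2 ⟨hcy, Filter.Eventually.of_forall fun k => hc _⟩)
  funext j
  refine le_antisymm ?_ ?_
  · exact le_of_tendsto ((continuous_apply j).continuousAt.tendsto.comp
      (key (fun k => a k j) (fun k => ha k j) fun k => hax k j))
      (Filter.Eventually.of_forall fun k => hFa _ j)
  · exact ge_of_tendsto ((continuous_apply j).continuousAt.tendsto.comp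
      (key (fun k => b k j) (fun k => hb k j) fun k => hbx k j))
      (Filter.Eventually.of_forall fun k => hFb _ j)

/-! ### Sign labellings of a triangulated cube. -/

theorem singleton_mem_faces {V : Type*} {K : PreAbstractSimplicialComplex V} {s : Finset V}
    (hs : s ∈ K.faces) {v : V} (hv : v ∈ s) : {v} ∈ K.faces :=
  (K.isRelLowerSet_faces hs).2 (Finset.singleton_subset_iff.2 hv) (Finset.singleton_nonempty v)

namespace DiscreteBox

/-- A labelling of the vertices by `n` sign vectors that has the signs of the identity on the
boundary and no opposite signs on an edge vanishes at some vertex. -/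
theorem exists_vertex_labels_eq_zero {V : Type*} [Finite V] {n : ℕ} (T : DiscreteBox V n)
    (lam : Fin n → T.Vertex → ℝ)
    (h0 : ∀ i (v : T.Vertex), {v.1} ∈ (T.B i).faces → lam i v ≤ 0)
    (h1 : ∀ i (v : T.Vertex), {v.1} ∈ (T.B' i).faces → 0 ≤ lam i v)
    (hadj : ∀ i v w, T.graph.Adj v w → 0 ≤ lam i v * lam i w) :
    ∃ v, ∀ i, lam i v = 0 := by
  classical
  obtain ⟨φ, hB, hB'⟩ := T.triangulates
  -- The simplexwise affine extension of the labels, transported to the cube by `φ`.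
  let F : (Fin n → ℝ) → Fin n → ℝ := fun y j => ∑ v : T.Vertex,
    lam j v * if hy : y ∈ Set.Icc (0 : Fin n → ℝ) 1 then (φ.symm ⟨y, hy⟩).1 v.1 else 0
  have hFφ : ∀ y (hy : y ∈ Set.Icc (0 : Fin n → ℝ) 1) j,
      F y j = ∑ v : T.Vertex, lam j v * (φ.symm ⟨y, hy⟩).1 v.1 := by
    intro y hy j
    simp only [F, dif_pos hy]
  have hF : ContinuousOn F (Set.Icc 0 1) := by
    rw [continuousOn_iff_continuous_domRestrict]
    refine continuous_pi fun j => ?_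
    have : (fun y => (Set.Icc (0 : Fin n → ℝ) 1).domRestrict F y j) = fun y =>
        ∑ v : T.Vertex, lam j v * (φ.symm y).1 v.1 := by
      funext y
      exact hFφ y.1 y.2 j
    rw [this]
    refine continuous_finsetSum _ fun v _ => continuous_const.mul ?_
    exact (continuous_apply v.1).comp (continuous_subtype_val.comp φ.symm.continuous)
  obtain ⟨y, hy, hy0⟩ := poincare_miranda hF
    (fun y hy j hyj => by
      rw [hFφ y hy]
      have hx := (hB j (φ.symm ⟨y, hy⟩)).2 (by simpa using hyj)
      obtain ⟨s, hs, hs0, hpos, -⟩ := hx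
      refine Finset.sum_nonpos fun v _ => ?_
      by_cases hv : v.1 ∈ s
      · exact mul_nonpos_of_nonpos_of_nonneg (h0 j v (singleton_mem_faces hs hv)) (hpos _)
      · rw [hs0 _ hv, mul_zero])
    (fun y hy j hyj => by
      rw [hFφ y hy]
      have hx := (hB' j (φ.symm ⟨y, hy⟩)).2 (by simpa using hyj)
      obtain ⟨s, hs, hs0, hpos, -⟩ := hx
      refine Finset.sum_nonneg fun v _ => ?_
      by_cases hv : v.1 ∈ s
      · exact mul_nonneg (h1 j v (singleton_mem_faces hs hv)) (hpos _)
      · rw [hs0 _ hv, mul_zero])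
  obtain ⟨s, hs, hs0, hpos, hs1⟩ := (φ.symm ⟨y, hy⟩).2
  obtain ⟨v, hvs, hv⟩ : ∃ v ∈ s, (φ.symm ⟨y, hy⟩).1 v ≠ 0 :=
    Finset.exists_ne_zero_of_sum_ne_zero (hs1.trans_ne one_ne_zero)
  let v' : T.Vertex := ⟨v, singleton_mem_faces hs hvs⟩
  refine ⟨v', fun j => ?_⟩
  -- Multiplied by the label of a carrier vertex, all terms become nonnegative, since carrier
  -- vertices are equal or adjacent. A vanishing sum kills the term of `v'` itself, a positive
  -- multiple of `lam j v' ^ 2`.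
  have hsum : ∑ w : T.Vertex, lam j v' * (lam j w * (φ.symm ⟨y, hy⟩).1 w.1) = 0 := by
    rw [← Finset.mul_sum, ← hFφ y hy, hy0]
    simp
  have hterm := (Finset.sum_eq_zero_iff_of_nonneg (fun w _ => ?_)).1 hsum v' (Finset.mem_univ _)
  · simpa [v', hv] using hterm
  · by_cases hw : w.1 ∈ s
    · rw [← mul_assoc]
      refine mul_nonneg ?_ (hpos _)
      rcases eq_or_ne v' w with rfl | hne
      · exact mul_self_nonneg _
      · exact hadj j _ _ ⟨hne, s, hs, hvs, hw⟩
    · rw [hs0 _ hw, mul_zero, mul_zero]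

/-- Opposite faces are disjoint. -/
theorem notMem_B'_of_mem_B {V : Type*} {n : ℕ} (T : DiscreteBox V n) {i : Fin n} {v : V}
    (hv : {v} ∈ (T.B i).faces) : {v} ∉ (T.B' i).faces := by
  classical
  intro hv'
  obtain ⟨φ, hB, hB'⟩ := T.triangulates
  have hmem : ∀ K : PreAbstractSimplicialComplex V, {v} ∈ K.faces →
      (Pi.single v 1 : V → ℝ) ∈ realization K := by
    intro K hK
    refine ⟨{v}, hK, fun w hw => ?_, fun w => ?_, by simp⟩
    · exact Pi.single_eq_of_ne (by simpa using hw) _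
    · rcases eq_or_ne w v with rfl | hw <;> simp [*]
  let x : realization T.complex := ⟨Pi.single v 1, hmem _ (T.B_le i hv)⟩
  have h0 := (hB i x).1 (hmem _ hv)
  have h1 := (hB' i x).1 (hmem _ hv')
  exact zero_ne_one (h0.symm.trans h1)

end DiscreteBox

/-! ### Cube packings and paths along lines. -/

/-- Cubes indexed by the vertices of a discrete box, inside a geometric box, with adjacent cubes
touching and the cubes of the boundary vertices touching the corresponding faces, such that the
nondegenerate ones do not overlap. -/
structure CubePacking {V : Type*} {n : ℕ} (T : DiscreteBox V n) (h : Fin n → ℝ) where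
  corner : T.Vertex → Fin n → ℝ
  side : T.Vertex → ℝ≥0
  corner_nonneg : ∀ v j, 0 ≤ corner v j
  corner_add_le : ∀ v j, corner v j + side v ≤ h j
  separated : ∀ v w, v ≠ w → 0 < side v → 0 < side w →
    ∃ j, corner v j + side v ≤ corner w j ∨ corner w j + side w ≤ corner v j
  adj : ∀ v w, T.graph.Adj v w → ∀ j, corner v j ≤ corner w j + side w
  corner_eq : ∀ i (v : T.Vertex), {v.1} ∈ (T.B i).faces → corner v i = 0
  corner_add_eq : ∀ i (v : T.Vertex), {v.1} ∈ (T.B' i).faces → corner v i + side v = h i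

namespace CubePacking

variable {V : Type*} {n : ℕ} {T : DiscreteBox V n} {h : Fin n → ℝ}

/-- The vertices whose cubes meet the line through `y` in direction `i`. -/
def lineVertices (P : CubePacking T h) (i : Fin n) (y : Fin n → ℝ) : Set T.Vertex :=
  {v | ∀ j, j ≠ i → P.corner v j ≤ y j ∧ y j ≤ P.corner v j + P.side v}

/-- The vertices whose cubes meet a line contain a path between the opposite faces. -/
theorem exists_path_lineVertices [Finite V] (P : CubePacking T h) (i : Fin n) {y : Fin n → ℝ}
    (hy : y ∈ Set.Icc 0 h) :
    ∃ v w : T.Vertex, {v.1} ∈ (T.B i).faces ∧ {w.1} ∈ (T.B' i).faces ∧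
      ∃ γ : T.graph.Path v w, ∀ u ∈ γ.1.support, u ∈ P.lineVertices i y := by
  classical
  set A := P.lineVertices i y
  let R : T.Vertex → Prop := fun w => ∃ hw : w ∈ A, ∃ v : A, {v.1.1} ∈ (T.B i).faces ∧
    (T.graph.induce A).Reachable v ⟨w, hw⟩
  by_cases hR : ∃ w, R w ∧ {w.1} ∈ (T.B' i).faces
  · obtain ⟨w, ⟨hw, v, hv, hvw⟩, hw'⟩ := hR
    obtain ⟨p⟩ := hvw
    let γ := (p.toPath).mapEmbedding (SimpleGraph.Embedding.induce A)
    refine ⟨v.1, w, hv, hw', γ, fun u hu => ?_⟩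
    have : u ∈ (p.toPath.1.support).map (SimpleGraph.Embedding.induce (G := T.graph) A) := by
      have h2 := SimpleGraph.Walk.support_map
        (SimpleGraph.Embedding.induce (G := T.graph) A).toHom p.toPath.1
      exact h2 ▸ hu
    obtain ⟨a, -, rfl⟩ := List.mem_map.1 this
    exact a.2
  · exfalso
    push Not at hR
    -- In direction `i` the label separates the line vertices reachable from `B i` from the others;
    -- in direction `j ≠ i` it records on which side of the line the cube lies. Touching cubes never
    -- lie strictly on opposite sides. A vertex with all labels zero would be on the line, where the
    -- label in direction `i` is `±1`.
    let lam : Fin n → T.Vertex → ℝ := fun j v =>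
      if j = i then (if R v then -1 else if v ∈ A then 1 else 0)
      else (if y j < P.corner v j then 1 else if P.corner v j + P.side v < y j then -1 else 0)
    obtain ⟨v, hv⟩ : ∃ v, ∀ j, lam j v = 0 := by
      refine T.exists_vertex_labels_eq_zero lam ?_ ?_ ?_
      · intro j v hvB
        simp only [lam]
        split_ifs with h1 h2 h3 h4 h5
        · norm_num
        · exact absurd ⟨h3, ⟨v, h3⟩, h1 ▸ hvB, SimpleGraph.Reachable.refl _⟩ h2
        · exact le_rfl
        · rw [P.corner_eq j v hvB] at h4
          exact absurd (hy.1 j) (not_le.2 h4)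
        · norm_num
        · exact le_rfl
      · intro j v hvB
        simp only [lam]
        split_ifs with h1 h2 h3 h4 h5
        · exact absurd (h1 ▸ hvB) (hR v h2)
        · norm_num
        · exact le_rfl
        · norm_num
        · rw [P.corner_add_eq j v hvB] at h5
          exact absurd (hy.2 j) (not_le.2 h5)
        · exact le_rfl
      · intro j v w hvw
        have key : ∀ v w, T.graph.Adj v w → R v → w ∈ A → R w := by
          rintro v w hvw ⟨hv, a, ha, hav⟩ hw
          refine ⟨hw, a, ha, hav.trans (SimpleGraph.Adj.reachable ?_)⟩
          exact hvw
        by_cases hj : j = i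
        · simp only [lam, if_pos hj]
          by_cases hv : R v <;> by_cases hw : R w <;> by_cases hv' : v ∈ A <;>
            by_cases hw' : w ∈ A <;> simp only [hv, hw, hv', hw', if_true, if_false] <;>
            norm_num
          · exact hw (key v w hvw hv hw')
          · exact hw (key v w hvw hv hw')
          · exact hv (key w v hvw.symm hw hv')
          · exact hv (key w v hvw.symm hw hv')
        · have h1 := P.adj v w hvw j
          have h2 := P.adj w v hvw.symm j
          simp only [lam, if_neg hj]
          split_ifs <;> first | (exfalso; linarith) | norm_num
    have hvA : v ∈ A := by
      intro j hj
      have := hv j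
      simp only [lam, if_neg hj] at this
      split_ifs at this with h1 h2
      · exact absurd this (by norm_num)
      · exact absurd this (by norm_num)
      · exact ⟨not_lt.1 h1, not_lt.1 h2⟩
    have := hv i
    simp only [lam, if_pos rfl, if_pos hvA] at this
    split_ifs at this <;> norm_num at this

end CubePacking

/-! ### Hölder's inequality and its equality case. -/

theorem succ_mul_mul_pow_le {x s : ℝ} (hx : 0 ≤ x) (hs : 0 ≤ s) (k : ℕ) :
    (k + 1) * (x * s ^ k) ≤ x ^ (k + 1) + k * s ^ (k + 1) := by
  induction k with
  | zero => simp
  | succ k ih =>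
    have h1 : 0 ≤ x * (x ^ (k + 1) + k * s ^ (k + 1) - (k + 1) * (x * s ^ k)) :=
      mul_nonneg hx (sub_nonneg.2 ih)
    have h2 : 0 ≤ (k + 1) * (s ^ k * (x - s) ^ 2) := by positivity
    push_cast
    have e : x ^ (k + 1 + 1) + (k + 1) * s ^ (k + 1 + 1) - (k + 1 + 1) * (x * s ^ (k + 1)) =
      x * (x ^ (k + 1) + k * s ^ (k + 1) - (k + 1) * (x * s ^ k)) +
        (k + 1) * (s ^ k * (x - s) ^ 2) := by ring
    linarith

/-- The square in the inductive identity must vanish. The exponent starts at 2 because for exponent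
1 the inequality is always an equality. -/
theorem eq_of_succ_mul_mul_pow_eq {x s : ℝ} (hx : 0 ≤ x) (hs : 0 ≤ s) (k : ℕ)
    (h : (k + 1 + 1) * (x * s ^ (k + 1)) = x ^ (k + 1 + 1) + (k + 1) * s ^ (k + 1 + 1)) :
    x = s := by
  have h1 : 0 ≤ x * (x ^ (k + 1) + k * s ^ (k + 1) - (k + 1) * (x * s ^ k)) :=
    mul_nonneg hx (sub_nonneg.2 (succ_mul_mul_pow_le hx hs k))
  have h2 : 0 ≤ (k + 1) * (s ^ k * (x - s) ^ 2) := by positivity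
  have e : x ^ (k + 1 + 1) + (k + 1) * s ^ (k + 1 + 1) - (k + 1 + 1) * (x * s ^ (k + 1)) =
    x * (x ^ (k + 1) + k * s ^ (k + 1) - (k + 1) * (x * s ^ k)) +
      (k + 1) * (s ^ k * (x - s) ^ 2) := by ring
  have h3 : (k + 1) * (s ^ k * (x - s) ^ 2) = 0 := by linarith
  have hk : (k : ℝ) + 1 ≠ 0 := by positivity
  rcases mul_eq_zero.1 ((mul_eq_zero.1 h3).resolve_left hk) with h4 | h4
  · have hs0 : s = 0 := eq_zero_of_pow_eq_zero h4
    subst hs0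
    simp only [ne_eq, Nat.add_eq_zero_iff, one_ne_zero, and_false, not_false_eq_true, zero_pow,
      mul_zero, add_zero] at h
    exact eq_zero_of_pow_eq_zero h.symm
  · exact sub_eq_zero.1 (eq_zero_of_pow_eq_zero h4)

/-- Hölder's inequality for the exponents `k + 1` and `(k + 1) / k`. -/
theorem sum_mul_pow_le_one {ι : Type*} [Fintype ι] {x y : ι → ℝ} (hx : ∀ i, 0 ≤ x i)
    (hy : ∀ i, 0 ≤ y i) (k : ℕ) (hx1 : ∑ i, x i ^ (k + 1) = 1) (hy1 : ∑ i, y i ^ (k + 1) ≤ 1) :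
    ∑ i, x i * y i ^ k ≤ 1 := by
  have h : ∑ i, (k + 1) * (x i * y i ^ k) ≤ ∑ i, (x i ^ (k + 1) + k * y i ^ (k + 1)) :=
    Finset.sum_le_sum fun i _ => succ_mul_mul_pow_le (hx i) (hy i) k
  rw [← Finset.mul_sum, Finset.sum_add_distrib, ← Finset.mul_sum, hx1] at h
  have hk : (0 : ℝ) ≤ k := Nat.cast_nonneg k
  have h2 := mul_le_mul_of_nonneg_left hy1 hk
  nlinarith

/-- The equality case of Hölder's inequality. -/
theorem eq_of_one_le_sum_mul_pow {ι : Type*} [Fintype ι] {x y : ι → ℝ} (hx : ∀ i, 0 ≤ x i)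
    (hy : ∀ i, 0 ≤ y i) (k : ℕ) (hx1 : ∑ i, x i ^ (k + 1 + 1) = 1)
    (hy1 : ∑ i, y i ^ (k + 1 + 1) ≤ 1) (h : 1 ≤ ∑ i, x i * y i ^ (k + 1)) : x = y := by
  have hle : ∀ i, ((k + 1 : ℕ) + 1 : ℝ) * (x i * y i ^ (k + 1)) ≤
      x i ^ (k + 1 + 1) + (k + 1 : ℕ) * y i ^ (k + 1 + 1) :=
    fun i => succ_mul_mul_pow_le (hx i) (hy i) (k + 1)
  have hk : (0 : ℝ) ≤ (k + 1 : ℕ) := Nat.cast_nonneg _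
  have h2 := mul_le_mul_of_nonneg_left hy1 hk
  have hsum : ∑ i, ((k + 1 : ℕ) + 1 : ℝ) * (x i * y i ^ (k + 1)) =
      ∑ i, (x i ^ (k + 1 + 1) + (k + 1 : ℕ) * y i ^ (k + 1 + 1)) := by
    refine le_antisymm (Finset.sum_le_sum fun i _ => hle i) ?_
    rw [← Finset.mul_sum, Finset.sum_add_distrib, ← Finset.mul_sum, hx1]
    have := mul_le_mul_of_nonneg_left h (by positivity : (0 : ℝ) ≤ (k + 1 : ℕ) + 1)
    linarith
  funext i
  refine eq_of_succ_mul_mul_pow_eq (hx i) (hy i) k ?_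
  have := (Finset.sum_eq_sum_iff_of_le fun i _ => hle i).1 hsum i (Finset.mem_univ i)
  push_cast at this
  exact this

/-! ### The length–area method and the value of the extremal length. -/

namespace CubePacking

variable {V : Type*}

/-- The total volume of the cubes is at most the volume of the box. -/
theorem sum_side_pow_le [Finite V] {n : ℕ} {T : DiscreteBox V n} {h : Fin n → ℝ}
    (P : CubePacking T h) (hpos : ∀ i, 0 ≤ h i) (hn : n ≠ 0) :
    ∑ v, (P.side v : ℝ) ^ n ≤ ∏ i, h i := by
  let U : T.Vertex → Set (Fin n → ℝ) := fun v =>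
    Set.univ.pi fun j => Set.Ioo (P.corner v j) (P.corner v j + P.side v)
  have hvol : ∀ v, MeasureTheory.volume (U v) = ENNReal.ofReal ((P.side v : ℝ) ^ n) := by
    intro v
    rw [Real.volume_pi_Ioo]
    simp [ENNReal.ofReal_pow]
  have hdisj : Pairwise (Function.onFun Disjoint U) := by
    intro v w hvw
    refine Set.disjoint_left.2 fun x hx hx' => ?_
    have hx := fun j => hx j (Set.mem_univ j)
    have hx' := fun j => hx' j (Set.mem_univ j)
    simp only [Set.mem_Ioo] at hx hx'
    -- A coordinate is needed to see that the open cube of a null vertex is empty, so that only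
    -- nondegenerate cubes can overlap.
    let j₀ : Fin n := ⟨0, Nat.pos_of_ne_zero hn⟩
    have hv : 0 < P.side v := by
      have := hx j₀
      exact_mod_cast (by linarith : (0 : ℝ) < P.side v)
    have hw : 0 < P.side w := by
      have := hx' j₀
      exact_mod_cast (by linarith : (0 : ℝ) < P.side w)
    obtain ⟨j, hj | hj⟩ := P.separated v w hvw hv hw
    · linarith [(hx j).2, (hx' j).1]
    · linarith [(hx j).1, (hx' j).2]
  have hsub : (⋃ v, U v) ⊆ Set.Icc 0 h := by
    refine Set.iUnion_subset fun v x hx => ⟨fun j => ?_, fun j => ?_⟩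
    · exact (P.corner_nonneg v j).trans (hx j (Set.mem_univ j)).1.le
    · exact (hx j (Set.mem_univ j)).2.le.trans (P.corner_add_le v j)
  have hle := MeasureTheory.measure_mono (μ := MeasureTheory.volume) hsub
  rw [MeasureTheory.measure_iUnion hdisj
    (fun v => MeasurableSet.univ_pi fun j => measurableSet_Ioo), tsum_fintype,
    Real.volume_Icc_pi] at hle
  simp only [hvol, Pi.zero_apply, sub_zero] at hle
  rw [← ENNReal.ofReal_sum_of_nonneg (fun v _ => by positivity),
    ← ENNReal.ofReal_prod_of_nonneg (fun i _ => hpos i),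
    ENNReal.ofReal_le_ofReal_iff (Finset.prod_nonneg fun i _ => hpos i)] at hle
  exact hle

/-- Consecutive cubes touch, so each vertex of a walk advances the coordinate `i` by at most its
side. -/
theorem le_sum_side_of_walk {n : ℕ} {T : DiscreteBox V n} {h : Fin n → ℝ}
    (P : CubePacking T h) (i : Fin n) {v w : T.Vertex} (γ : T.graph.Walk v w) :
    P.corner w i + P.side w ≤ P.corner v i + (γ.support.map fun u => (P.side u : ℝ)).sum := by
  induction γ with
  | nil => simp
  | cons hadj p ih =>
    have := P.adj _ _ hadj.symm i
    rw [SimpleGraph.Walk.support_cons, List.map_cons, List.sum_cons]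
    linarith

variable {k : ℕ} {T : DiscreteBox V (k + 1)} {h : Fin (k + 1) → ℝ}

theorem length_le_sum_lineVertices [Finite V] (P : CubePacking T h) (m : T.Vertex → ℝ≥0)
    {y : Fin (k + 1) → ℝ} (hy : y ∈ Set.Icc 0 h) :
    T.length m ≤ ∑ v, (P.lineVertices 0 y).indicator (fun v => (m v : ℝ)) v := by
  classical
  obtain ⟨v, w, hv, hw, γ, hγ⟩ := P.exists_path_lineVertices 0 hy
  have hbdd : BddBelow (T.pathLengths m) := by
    refine ⟨0, ?_⟩
    rintro _ ⟨v, w, -, -, γ, rfl⟩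
    refine List.sum_nonneg fun x hx => ?_
    obtain ⟨u, -, rfl⟩ := List.mem_map.1 hx
    exact NNReal.coe_nonneg _
  refine (csInf_le hbdd ⟨v, w, hv, hw, γ, rfl⟩).trans ?_
  rw [← List.sum_toFinset _ γ.2.support_nodup]
  calc ∑ u ∈ γ.1.support.toFinset, (m u : ℝ)
      = ∑ u ∈ γ.1.support.toFinset,
          (P.lineVertices 0 y).indicator (fun v => (m v : ℝ)) u := by
        refine Finset.sum_congr rfl fun u hu => ?_
        rw [Set.indicator_of_mem (hγ u (List.mem_toFinset.1 hu))]
    _ ≤ _ := Finset.sum_le_sum_of_subset_of_nonneg (Finset.subset_univ _)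
        fun u _ _ => Set.indicator_nonneg (fun _ _ => NNReal.coe_nonneg _) _

/-- The length–area estimate. -/
theorem length_mul_prod_le [Finite V] (P : CubePacking T h) (hpos : ∀ i, 0 ≤ h i)
    (m : T.Vertex → ℝ≥0) :
    T.length m * ∏ i, h i ≤ h 0 * ∑ v, (m v : ℝ) * (P.side v : ℝ) ^ k := by
  classical
  -- The prism swept out by the cube in direction `0`: within the box, `y ∈ Q v` says that the line
  -- through `y` meets the cube. Its volume is `h 0` times the power `k` of the side.
  let Q : T.Vertex → Set (Fin (k + 1) → ℝ) := fun v =>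
    Set.Icc (Fin.cons 0 fun j => P.corner v j.succ)
      (Fin.cons (h 0) fun j => P.corner v j.succ + P.side v)
  have hQ : ∀ v, MeasureTheory.volume (Q v) = ENNReal.ofReal (h 0 * (P.side v : ℝ) ^ k) := by
    intro v
    rw [Real.volume_Icc_pi, Fin.prod_univ_succ]
    simp [ENNReal.ofReal_mul (hpos 0), ENNReal.ofReal_pow]
  have hbox : MeasureTheory.volume (Set.Icc 0 h) = ENNReal.ofReal (∏ i, h i) := by
    rw [Real.volume_Icc_pi, ENNReal.ofReal_prod_of_nonneg fun i _ => hpos i]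
    simp
  have hpt : ∀ y ∈ Set.Icc 0 h, ENNReal.ofReal (T.length m) ≤
      ∑ v, (Q v).indicator (fun _ => ENNReal.ofReal (m v)) y := by
    intro y hy
    refine (ENNReal.ofReal_le_ofReal (P.length_le_sum_lineVertices m hy)).trans ?_
    rw [ENNReal.ofReal_sum_of_nonneg
      fun v _ => Set.indicator_nonneg (fun _ _ => NNReal.coe_nonneg _) _]
    refine Finset.sum_le_sum fun v _ => ?_
    by_cases hv : v ∈ P.lineVertices 0 y
    · rw [Set.indicator_of_mem hv, Set.indicator_of_mem]
      refine ⟨fun j => ?_, fun j => ?_⟩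
      · refine Fin.cases ?_ (fun j => ?_) j
        · exact hy.1 0
        · exact (hv j.succ (Fin.succ_ne_zero j)).1
      · refine Fin.cases ?_ (fun j => ?_) j
        · exact hy.2 0
        · exact (hv j.succ (Fin.succ_ne_zero j)).2
    · rw [Set.indicator_of_notMem hv]
      simp
  have hint : ∫⁻ _ in Set.Icc 0 h, ENNReal.ofReal (T.length m) ≤
      ∫⁻ y, ∑ v, (Q v).indicator (fun _ => ENNReal.ofReal (m v)) y :=
    (MeasureTheory.setLIntegral_mono' measurableSet_Icc hpt).trans
      (MeasureTheory.setLIntegral_le_lintegral _ _)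
  rw [MeasureTheory.setLIntegral_const, MeasureTheory.lintegral_finsetSum _
    (fun v _ => measurable_const.indicator measurableSet_Icc), hbox] at hint
  simp only [MeasureTheory.lintegral_indicator_const measurableSet_Icc, hQ, Q] at hint
  have hprod : 0 ≤ ∏ i, h i := Finset.prod_nonneg fun i _ => hpos i
  rw [← ENNReal.ofReal_mul' hprod] at hint
  have hint' : ENNReal.ofReal (T.length m * ∏ i, h i) ≤
      ENNReal.ofReal (h 0 * ∑ v, (m v : ℝ) * (P.side v : ℝ) ^ k) := by
    refine hint.trans (le_of_eq ?_)
    rw [Finset.mul_sum, ENNReal.ofReal_sum_of_nonneg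
      fun v _ => mul_nonneg (hpos 0) (by positivity)]
    refine Finset.sum_congr rfl fun v _ => ?_
    rw [← ENNReal.ofReal_mul (NNReal.coe_nonneg _)]
    congr 1
    ring
  exact (ENNReal.ofReal_le_ofReal_iff (mul_nonneg (hpos 0)
    (Finset.sum_nonneg fun v _ => by positivity))).1 hint'

end CubePacking

theorem DiscreteBox.volume_nonneg {V : Type*} [Finite V] {n : ℕ} (T : DiscreteBox V n)
    (m : T.Vertex → ℝ≥0) : 0 ≤ T.volume m :=
  Real.rpow_nonneg (Finset.sum_nonneg fun _ _ => by positivity) _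

theorem DiscreteBox.volume_pow {V : Type*} [Finite V] {n : ℕ} (hn : n ≠ 0) (T : DiscreteBox V n)
    (m : T.Vertex → ℝ≥0) : T.volume m ^ n = ∑ v, (m v : ℝ) ^ n := by
  rw [DiscreteBox.volume, one_div]
  exact Real.rpow_inv_natCast_pow (Finset.sum_nonneg fun _ _ => by positivity) hn

namespace CubePacking

variable {V : Type*} [Finite V] {k : ℕ} {T : DiscreteBox V (k + 1)} {h : Fin (k + 1) → ℝ}

theorem le_length_side (P : CubePacking T h) (hpos : ∀ i, 0 ≤ h i) : h 0 ≤ T.length P.side := by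
  refine le_csInf ?_ ?_
  · obtain ⟨v, w, hv, hw, γ, -⟩ := P.exists_path_lineVertices 0 (y := 0) ⟨le_rfl, hpos⟩
    exact ⟨_, v, w, hv, hw, γ, rfl⟩
  · rintro _ ⟨v, w, hv, hw, γ, rfl⟩
    have := P.le_sum_side_of_walk 0 γ.1
    rwa [P.corner_eq 0 v hv, P.corner_add_eq 0 w hw, zero_add] at this

theorem sum_div_pow_eq_one {m : T.Vertex → ℝ≥0} (hm : 0 < T.volume m) :
    ∑ v, ((m v : ℝ) / T.volume m) ^ (k + 1) = 1 := by
  simp only [div_pow]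
  rw [← Finset.sum_div, ← T.volume_pow k.succ_ne_zero, div_self (by positivity)]

theorem sum_side_div_pow_le_one (P : CubePacking T h) (hpos : ∀ i, 0 ≤ h i) {S : ℝ} (hS : 0 < S)
    (hSh : S ^ (k + 1) = ∏ i, h i) : ∑ v, ((P.side v : ℝ) / S) ^ (k + 1) ≤ 1 := by
  simp only [div_pow]
  rw [← Finset.sum_div, div_le_one (by positivity), hSh]
  exact P.sum_side_pow_le hpos k.succ_ne_zero

/-- The length–area estimate with both metrics normalized, in the shape to which Hölder's inequality
and its equality case apply. -/
theorem length_mul_le_mul_sum (P : CubePacking T h) (hpos : ∀ i, 0 ≤ h i) {S : ℝ} (hS : 0 < S)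
    (hSh : S ^ (k + 1) = ∏ i, h i) {m : T.Vertex → ℝ≥0} (hm : 0 < T.volume m) :
    T.length m * S ≤ h 0 * T.volume m *
      ∑ v, ((m v : ℝ) / T.volume m) * ((P.side v : ℝ) / S) ^ k := by
  have h1 := P.length_mul_prod_le hpos m
  have h2 : ∑ v, ((m v : ℝ) / T.volume m) * ((P.side v : ℝ) / S) ^ k =
      (∑ v, (m v : ℝ) * (P.side v : ℝ) ^ k) / (T.volume m * S ^ k) := by
    rw [Finset.sum_div]
    refine Finset.sum_congr rfl fun v _ => ?_
    rw [div_pow, div_mul_div_comm]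
  rw [← hSh] at h1
  rw [h2, mul_div_assoc', le_div_iff₀ (by positivity)]
  calc T.length m * S * (T.volume m * S ^ k) = T.length m * S ^ (k + 1) * T.volume m := by ring
    _ ≤ (h 0 * ∑ v, (m v : ℝ) * (P.side v : ℝ) ^ k) * T.volume m := by gcongr
    _ = _ := by ring

theorem length_mul_le (P : CubePacking T h) (hpos : ∀ i, 0 ≤ h i) {S : ℝ} (hS : 0 < S)
    (hSh : S ^ (k + 1) = ∏ i, h i) {m : T.Vertex → ℝ≥0} (hm : 0 < T.volume m) :
    T.length m * S ≤ h 0 * T.volume m := by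
  refine (P.length_mul_le_mul_sum hpos hS hSh hm).trans ?_
  refine mul_le_of_le_one_right (mul_nonneg (hpos 0) hm.le) ?_
  exact sum_mul_pow_le_one (fun v => by positivity) (fun v => by positivity) k
    (sum_div_pow_eq_one hm) (P.sum_side_div_pow_le_one hpos hS hSh)

/-- The extremal length of a discrete box with a cube packing is that of the geometric box. -/
theorem EL_eq (P : CubePacking T h) (hpos : ∀ i, 0 < h i) :
    T.EL = h 0 / (∏ i, h i) ^ (((k + 1 : ℕ) : ℝ)⁻¹) := by
  have hpos' : ∀ i, 0 ≤ h i := fun i => (hpos i).le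
  have hprod : 0 < ∏ i, h i := Finset.prod_pos fun i _ => hpos i
  set S := (∏ i, h i) ^ (((k + 1 : ℕ) : ℝ)⁻¹) with hS_def
  have hS : 0 < S := Real.rpow_pos_of_pos hprod _
  have hSh : S ^ (k + 1) = ∏ i, h i := Real.rpow_inv_natCast_pow hprod.le k.succ_ne_zero
  have hlen := P.le_length_side hpos'
  have hvolS : T.volume P.side ≤ S := by
    refine le_of_pow_le_pow_left₀ k.succ_ne_zero hS.le ?_
    rw [T.volume_pow k.succ_ne_zero, hSh]
    exact P.sum_side_pow_le hpos' k.succ_ne_zero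
  have hvol : 0 < T.volume P.side := by
    refine (T.volume_nonneg _).lt_of_ne' fun h0 => ?_
    have hside : ∀ v, P.side v = 0 := by
      intro v
      have := T.volume_pow k.succ_ne_zero P.side
      rw [h0, zero_pow k.succ_ne_zero, eq_comm,
        Finset.sum_eq_zero_iff_of_nonneg fun v _ => by positivity] at this
      simpa using this v (Finset.mem_univ v)
    obtain ⟨v, w, hv, hw, γ, -⟩ := P.exists_path_lineVertices 0 (y := 0) ⟨le_rfl, hpos'⟩
    have := P.le_sum_side_of_walk 0 γ.1
    rw [P.corner_eq 0 v hv, P.corner_add_eq 0 w hw] at this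
    simp only [hside, NNReal.coe_zero, List.map_const', List.sum_replicate, smul_zero,
      add_zero] at this
    exact absurd this (not_le.2 (hpos 0))
  have hup : ∀ m, 0 < T.volume m → T.normalizedLength m ≤ h 0 / S := by
    intro m hm
    rw [DiscreteBox.normalizedLength, div_le_div_iff₀ hm hS]
    exact P.length_mul_le hpos' hS hSh hm
  refine IsGreatest.csSup_eq ⟨⟨P.side, hvol, le_antisymm (hup _ hvol) ?_⟩, ?_⟩
  · rw [DiscreteBox.normalizedLength]
    gcongr
    exact (hpos' 0).trans hlen
  · rintro _ ⟨m, hm, rfl⟩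
    exact hup m hm

end CubePacking

/-- In dimension at least two every extremal metric is proportional to the side lengths. -/
theorem CubePacking.eq_of_isExtremal {V : Type*} [Finite V] {k : ℕ} {T : DiscreteBox V (k + 1 + 1)}
    {h : Fin (k + 1 + 1) → ℝ} (P : CubePacking T h) (hpos : ∀ i, 0 < h i)
    {m : T.Vertex → ℝ≥0} (hm : T.IsExtremal m) :
    ∃ c : ℝ, 0 < c ∧ ∀ v, (m v : ℝ) = c * P.side v := by
  have hpos' : ∀ i, 0 ≤ h i := fun i => (hpos i).le
  have hprod : 0 < ∏ i, h i := Finset.prod_pos fun i _ => hpos i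
  obtain ⟨hm0, hmEL⟩ := hm
  rw [P.EL_eq hpos] at hmEL
  set S := (∏ i, h i) ^ (((k + 1 + 1 : ℕ) : ℝ)⁻¹) with hS_def
  have hS : 0 < S := Real.rpow_pos_of_pos hprod _
  have hSh : S ^ (k + 1 + 1) = ∏ i, h i :=
    Real.rpow_inv_natCast_pow hprod.le (k + 1).succ_ne_zero
  rw [DiscreteBox.normalizedLength, div_eq_div_iff hm0.ne' hS.ne'] at hmEL
  have h1 := P.length_mul_le_mul_sum hpos' hS hSh hm0
  rw [hmEL] at h1
  -- Extremality turns the left side into `h 0 * T.volume m`, so the Hölder sum is at least 1 and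
  -- the equality case applies.
  have h2 := (le_mul_iff_one_le_right (mul_pos (hpos 0) hm0)).1 h1
  have h3 := eq_of_one_le_sum_mul_pow (fun v => by positivity) (fun v => by positivity) k
    (CubePacking.sum_div_pow_eq_one hm0) (P.sum_side_div_pow_le_one hpos' hS hSh) h2
  refine ⟨T.volume m / S, by positivity, fun v => ?_⟩
  have := congrFun h3 v
  field_simp at this ⊢
  linarith

/-! ### Packings from permutations, faces and tilings. -/

/-- A cube packing for the box with renumbered faces. -/
def CubePacking.permute {V : Type*} {n : ℕ} {T : DiscreteBox V n} {h : Fin n → ℝ}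
    (P : CubePacking T h) (σ : Equiv.Perm (Fin n)) :
    CubePacking (T.permute σ) (fun i => h (σ i)) where
  corner v i := P.corner v (σ i)
  side v := P.side v
  corner_nonneg v j := P.corner_nonneg v (σ j)
  corner_add_le v j := P.corner_add_le v (σ j)
  separated v w hvw hv hw := by
    obtain ⟨j, hj⟩ := P.separated v w hvw hv hw
    exact ⟨σ.symm j, by simpa using hj⟩
  adj v w hvw j := P.adj v w hvw (σ j)
  corner_eq i v hv := P.corner_eq (σ i) v hv
  corner_add_eq i v hv := P.corner_add_eq (σ i) v hv

/-- The packing of a face `x i = 0` by the faces of the cubes that belong to it. -/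
def CubePacking.face {V : Type*} {n : ℕ} {T : DiscreteBox V (n + 1)} {h : Fin (n + 1) → ℝ}
    (P : CubePacking T h) (i : Fin (n + 1)) :
    CubePacking (T.face i) (fun j => h (i.succAbove j)) where
  corner v j := P.corner ⟨v.1, T.B_le i v.2⟩ (i.succAbove j)
  side v := P.side ⟨v.1, T.B_le i v.2⟩
  corner_nonneg v j := P.corner_nonneg _ _
  corner_add_le v j := P.corner_add_le _ _
  separated v w hvw hv hw := by
    obtain ⟨j, hj⟩ := P.separated ⟨v.1, T.B_le i v.2⟩ ⟨w.1, T.B_le i w.2⟩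
      (fun h => hvw (Subtype.ext (Subtype.mk.inj h))) hv hw
    -- Both cubes rest on `x i = 0` and have positive side, so they overlap in direction `i` and
    -- must be separated in another one.
    rcases Fin.eq_self_or_eq_succAbove i j with rfl | ⟨j, rfl⟩
    · rw [P.corner_eq j ⟨v.1, T.B_le j v.2⟩ v.2, P.corner_eq j ⟨w.1, T.B_le j w.2⟩ w.2, zero_add, zero_add] at hj
      have hv' : (0 : ℝ) < _ := NNReal.coe_pos.2 hv
      have hw' : (0 : ℝ) < _ := NNReal.coe_pos.2 hw
      exact absurd hj (by simp [hv'.not_ge, hw'.not_ge])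
    · exact ⟨j, hj⟩
  adj v w hvw j := P.adj _ _ ⟨fun h => hvw.1 (Subtype.ext (Subtype.mk.inj h)),
    hvw.2.imp fun _ hs => ⟨T.B_le i hs.1, hs.2⟩⟩ _
  corner_eq j v hv := P.corner_eq _ _ hv.2
  corner_add_eq j v hv := P.corner_add_eq _ _ hv.2

/-- The packing of a face `x i = h i` by the faces of the cubes that belong to it. -/
def CubePacking.face' {V : Type*} {n : ℕ} {T : DiscreteBox V (n + 1)} {h : Fin (n + 1) → ℝ}
    (P : CubePacking T h) (i : Fin (n + 1)) :
    CubePacking (T.face' i) (fun j => h (i.succAbove j)) where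
  corner v j := P.corner ⟨v.1, T.B'_le i v.2⟩ (i.succAbove j)
  side v := P.side ⟨v.1, T.B'_le i v.2⟩
  corner_nonneg v j := P.corner_nonneg _ _
  corner_add_le v j := P.corner_add_le _ _
  separated v w hvw hv hw := by
    obtain ⟨j, hj⟩ := P.separated ⟨v.1, T.B'_le i v.2⟩ ⟨w.1, T.B'_le i w.2⟩
      (fun h => hvw (Subtype.ext (Subtype.mk.inj h))) hv hw
    rcases Fin.eq_self_or_eq_succAbove i j with rfl | ⟨j, rfl⟩
    · have h1 := P.corner_add_eq j ⟨v.1, T.B'_le j v.2⟩ v.2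
      have h2 := P.corner_add_eq j ⟨w.1, T.B'_le j w.2⟩ w.2
      have hv' : (0 : ℝ) < _ := NNReal.coe_pos.2 hv
      have hw' : (0 : ℝ) < _ := NNReal.coe_pos.2 hw
      rcases hj with hj | hj <;> linarith
    · exact ⟨j, hj⟩
  adj v w hvw j := P.adj _ _ ⟨fun h => hvw.1 (Subtype.ext (Subtype.mk.inj h)),
    hvw.2.imp fun _ hs => ⟨T.B'_le i hs.1, hs.2⟩⟩ _
  corner_eq j v hv := P.corner_eq _ _ hv.2
  corner_add_eq j v hv := P.corner_add_eq _ _ hv.2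

theorem corner_mem_axisCube {n : ℕ} (a : Fin n → ℝ) (r : ℝ≥0) : a ∈ axisCube a r :=
  ⟨le_rfl, fun i => by simp⟩

/-- The cubes of a cube tiling form a packing. -/
def CubeTiling.packing {V : Type*} {n : ℕ} {T : DiscreteBox V n} {h : Fin n → ℝ}
    (C : CubeTiling T h) : CubePacking T h where
  corner := C.corner
  side := C.side
  corner_nonneg v j := by
    have : C.corner v ∈ Set.Icc 0 h := C.cover ▸ Set.mem_iUnion.2 ⟨v, corner_mem_axisCube _ _⟩
    exact this.1 j
  corner_add_le v j := by
    have : (fun i => C.corner v i + C.side v) ∈ Set.Icc 0 h :=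
      C.cover ▸ Set.mem_iUnion.2 ⟨v, fun i => by simp, le_rfl⟩
    exact this.2 j
  separated v w hvw hv hw := by
    by_contra! hcon
    have hv' : (0 : ℝ) < C.side v := NNReal.coe_pos.2 hv
    have hw' : (0 : ℝ) < C.side w := NNReal.coe_pos.2 hw
    -- The centre of the overlap is interior to both cubes, while common points have to be boundary
    -- points.
    let x : Fin n → ℝ := fun j => (max (C.corner v j) (C.corner w j) +
      min (C.corner v j + C.side v) (C.corner w j + C.side w)) / 2
    have hlt : ∀ j, max (C.corner v j) (C.corner w j) <
        min (C.corner v j + C.side v) (C.corner w j + C.side w) := by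
      intro j
      have := hcon j
      simp only [max_lt_iff, lt_min_iff]
      refine ⟨⟨?_, ?_⟩, ?_, ?_⟩ <;> linarith
    have hxv : ∀ j, C.corner v j < x j ∧ x j < C.corner v j + C.side v := by
      intro j
      have := hlt j
      have h1 := le_max_left (C.corner v j) (C.corner w j)
      have h2 := min_le_left (C.corner v j + C.side v) (C.corner w j + C.side w)
      constructor <;> simp only [x] <;> linarith
    have hxw : ∀ j, C.corner w j < x j ∧ x j < C.corner w j + C.side w := by
      intro j
      have := hlt j
      have h1 := le_max_right (C.corner v j) (C.corner w j)
      have h2 := min_le_right (C.corner v j + C.side v) (C.corner w j + C.side w)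
      constructor <;> simp only [x] <;> linarith
    have hmem := C.inter_subset v w hvw
      ⟨⟨fun j => (hxv j).1.le, fun j => (hxv j).2.le⟩,
        ⟨fun j => (hxw j).1.le, fun j => (hxw j).2.le⟩⟩
    refine hmem.1.2 (mem_interior.2 ⟨Set.univ.pi fun j =>
      Set.Ioo (C.corner v j) (C.corner v j + C.side v), fun y hy => ⟨fun j => ?_, fun j => ?_⟩,
      isOpen_set_pi Set.finite_univ fun _ _ => isOpen_Ioo, fun j _ => hxv j⟩)
    · exact (hy j (Set.mem_univ j)).1.le
    · exact (hy j (Set.mem_univ j)).2.le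
  adj v w hvw j := by
    obtain ⟨x, hx, hx'⟩ := C.adj v w hvw
    exact (hx.1 j).trans (hx'.2 j)
  corner_eq i v hv := by
    obtain ⟨x, hx, hxi⟩ := C.meets i v hv
    have : C.corner v ∈ Set.Icc 0 h := C.cover ▸ Set.mem_iUnion.2 ⟨v, corner_mem_axisCube _ _⟩
    exact le_antisymm (hxi ▸ hx.1 i) (this.1 i)
  corner_add_eq i v hv := by
    obtain ⟨x, hx, hxi⟩ := C.meets' i v hv
    have : (fun i => C.corner v i + C.side v) ∈ Set.Icc 0 h :=
      C.cover ▸ Set.mem_iUnion.2 ⟨v, fun i => by simp, le_rfl⟩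
    exact le_antisymm (this.2 i) (hxi ▸ hx.2 i)

/-! ### No tiling by cubes of distinct sizes in dimension at least three. -/

/-- The interval `[p, q]` contains `x` and the points close to `x` on the right (for `b = true`)
or on the left (for `b = false`) of it. -/
def GermMem (p q x : ℝ) (b : Bool) : Prop :=
  p ≤ x ∧ x ≤ q ∧ (b = true → x < q) ∧ (b = false → p < x)

/-- Two intervals with a common germ share a whole interval; thus cubes of a tiling that share a
germ in every direction coincide, which mere common points would not give. -/
theorem GermMem.overlap {p q p' q' x : ℝ} {b : Bool} (h : GermMem p q x b)
    (h' : GermMem p' q' x b) : p < q' ∧ p' < q := by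
  obtain ⟨h1, h2, h3, h4⟩ := h
  obtain ⟨h1', h2', h3', h4'⟩ := h'
  cases b
  · have := h4 rfl; have := h4' rfl
    constructor <;> linarith
  · have := h3 rfl; have := h3' rfl
    constructor <;> linarith

theorem germMem_true {p q x : ℝ} (h1 : p ≤ x) (h2 : x < q) : GermMem p q x true :=
  ⟨h1, h2.le, fun _ => h2, fun h => by simp at h⟩

theorem germMem_false {p q x : ℝ} (h1 : p < x) (h2 : x ≤ q) : GermMem p q x false :=
  ⟨h1.le, h2, fun h => by simp at h, fun _ => h1⟩

theorem GermMem.mono {p q p' q' x : ℝ} {b : Bool} (h : GermMem p q x b) (hp : p' ≤ p)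
    (hq : q ≤ q') : GermMem p' q' x b :=
  ⟨hp.trans h.1, h.2.1.trans hq, fun hb => (h.2.2.1 hb).trans_le hq,
    fun hb => hp.trans_lt (h.2.2.2 hb)⟩

/-- A tiling of the box `∏ [0, h i]` by nondegenerate cubes of pairwise different sizes. -/
structure PerfectCubing (ι K : Type*) where
  a : K → ι → ℝ
  s : K → ℝ
  h : ι → ℝ
  pos : ∀ v, 0 < s v
  nonneg : ∀ v j, 0 ≤ a v j
  le : ∀ v j, a v j + s v ≤ h j
  separated : ∀ v w, v ≠ w → ∃ j, a v j + s v ≤ a w j ∨ a w j + s w ≤ a v j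
  cover : ∀ (x : ι → ℝ) (d : ι → Bool), (∀ j, GermMem 0 (h j) (x j) (d j)) →
    ∃ w, ∀ j, GermMem (a w j) (a w j + s w) (x j) (d j)
  injective : Function.Injective s

namespace PerfectCubing

variable {ι K : Type*} (C : PerfectCubing ι K)

theorem eq_of_overlap {v w : K} (hvw : ∀ j, C.a v j < C.a w j + C.s w ∧ C.a w j < C.a v j + C.s v) :
    v = w := by
  by_contra hne
  obtain ⟨j, hj | hj⟩ := C.separated v w hne
  · exact absurd (hvw j).2 (not_lt.2 hj)
  · exact absurd (hvw j).1 (not_lt.2 hj)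

/-- The cube `w` stands on the horizontal rectangle `∏ [p j, q j]` at height `t` in direction
`o`, without filling it in any direction. -/
def StandsOn (o : ι) (p q : ι → ℝ) (t : ℝ) (w : K) : Prop :=
  C.a w o = t ∧ ∀ j, j ≠ o → p j ≤ C.a w j ∧ C.a w j + C.s w ≤ q j ∧ C.s w < q j - p j

/-- A horizontal rectangle at height `t`, inside the box, on which only cubes stand that do not
reach over its boundary. -/
structure Valley (o : ι) (p q : ι → ℝ) (t : ℝ) : Prop where
  height_nonneg : 0 ≤ t
  height_lt : t < C.h o
  lower_nonneg : ∀ j, j ≠ o → 0 ≤ p j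
  upper_le : ∀ j, j ≠ o → q j ≤ C.h j
  lt : ∀ j, j ≠ o → p j < q j
  standsOn : ∀ w, C.a w o ≤ t → t < C.a w o + C.s w →
    (∀ j, j ≠ o → C.a w j < q j ∧ p j < C.a w j + C.s w) → C.StandsOn o p q t w

variable {C} {o : ι} {p q : ι → ℝ} {t : ℝ}

theorem Valley.exists_standsOn (hV : C.Valley o p q t) {x : ι → ℝ} {d : ι → Bool}
    (hxo : x o = t) (hdo : d o = true)
    (hx : ∀ j, j ≠ o → GermMem (p j) (q j) (x j) (d j)) :
    ∃ w, C.StandsOn o p q t w ∧ ∀ j, GermMem (C.a w j) (C.a w j + C.s w) (x j) (d j) := by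
  obtain ⟨w, hw⟩ := C.cover x d fun j => by
    rcases eq_or_ne j o with rfl | hj
    · rw [hxo, hdo]
      exact germMem_true hV.height_nonneg hV.height_lt
    · exact (hx j hj).mono (hV.lower_nonneg j hj) (hV.upper_le j hj)
  refine ⟨w, hV.standsOn w ?_ ?_ fun j hj => ?_, hw⟩
  · exact hxo ▸ (hw o).1
  · exact hxo ▸ (hw o).2.2.1 hdo
  · exact (hw j).overlap (hx j hj)

/-- The smallest cube in a valley does not touch the walls of the valley from the right. -/
theorem Valley.lower_lt [DecidableEq ι] (hV : C.Valley o p q t) {c : K}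
    (hc : C.StandsOn o p q t c)
    (hmin : ∀ w, C.StandsOn o p q t w → w ≠ c → C.s c < C.s w) {j k : ι} (hj : j ≠ o) (hk : k ≠ o)
    (hjk : k ≠ j) : p j < C.a c j := by
  by_contra hcon
  have hcj : C.a c j = p j := le_antisymm (not_lt.1 hcon) (hc.2 j hj).1
  have hpos := C.pos c
  -- Suppose `c` touches the lower wall. Here `w` is the cube beyond its opposite side; being larger
  -- than `c`, it sticks out past `c` in direction `k`.
  obtain ⟨w, hw, hwx⟩ := hV.exists_standsOn (x := Function.update (C.a c) j (C.a c j + C.s c))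
    (d := fun _ => true) (by rw [Function.update_of_ne hj.symm, hc.1]) rfl (fun i hi => by
      have hci := hc.2 i hi
      rcases eq_or_ne i j with rfl | hij
      · rw [Function.update_self]
        exact germMem_true (by linarith) (by linarith)
      · rw [Function.update_of_ne hij]
        exact germMem_true hci.1 (by linarith))
  have hwj := hwx j
  rw [Function.update_self] at hwj
  have hwi : ∀ i, i ≠ j → GermMem (C.a w i) (C.a w i + C.s w) (C.a c i) true := fun i hi => by
    simpa [Function.update_of_ne hi] using hwx i
  have hwc : w ≠ c := by
    rintro rfl
    exact absurd (hwj.2.2.1 rfl) (lt_irrefl _)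
  have hlt := hmin w hw hwc
  have hwj' : C.a c j + C.s c ≤ C.a w j := by
    by_contra hlt'
    refine hwc (C.eq_of_overlap fun i => ?_)
    rcases eq_or_ne i j with rfl | hij
    · exact ⟨not_le.1 hlt', by linarith [hwj.2.2.1 rfl]⟩
    · exact (hwi i hij).overlap (germMem_true le_rfl (by linarith))
  have hwk := hwi k hjk
  have hwk' := hw.2 k hk
  obtain ⟨xk, b, hb, hPk, hck⟩ : ∃ xk b, GermMem (C.a w k) (C.a w k + C.s w) xk b ∧
      GermMem (p k) (q k) xk b ∧ ¬ GermMem (C.a c k) (C.a c k + C.s c) xk b := by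
    by_cases hup : C.a c k + C.s c < C.a w k + C.s w
    · have hg : GermMem (C.a w k) (C.a w k + C.s w) (C.a c k + C.s c) true :=
        germMem_true (by linarith [hwk.1]) hup
      exact ⟨_, true, hg, hg.mono hwk'.1 hwk'.2.1, fun h => lt_irrefl _ (h.2.2.1 rfl)⟩
    · have hg : GermMem (C.a w k) (C.a w k + C.s w) (C.a c k) false :=
        germMem_false (by linarith) hwk.2.1
      exact ⟨_, false, hg, hg.mono hwk'.1 hwk'.2.1, fun h => lt_irrefl _ (h.2.2.2 rfl)⟩
  -- The slot beside `c`, between the wall and `w`, is only as wide as `c`. The cube `w'` filling it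
  -- is larger, so it runs into `w`.
  obtain ⟨w', hw', hwx'⟩ := hV.exists_standsOn (x := Function.update (C.a c) k xk)
    (d := Function.update (fun _ => true) k b) (by rw [Function.update_of_ne hk.symm, hc.1])
    (by rw [Function.update_of_ne hk.symm]) (fun i hi => by
      have hci := hc.2 i hi
      rcases eq_or_ne i k with rfl | hik
      · simpa using hPk
      · rw [Function.update_of_ne hik, Function.update_of_ne hik]
        exact germMem_true hci.1 (by linarith))
  have hwi' : ∀ i, i ≠ k → GermMem (C.a w' i) (C.a w' i + C.s w') (C.a c i) true := fun i hi => by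
    simpa [Function.update_of_ne hi] using hwx' i
  have hwk'' : GermMem (C.a w' k) (C.a w' k + C.s w') xk b := by simpa using hwx' k
  have hwc' : w' ≠ c := by
    rintro rfl
    exact hck hwk''
  have hlt' := hmin w' hw' hwc'
  have hnext_mem := hw'.2 j hj
  have hnext_germ := hwi' j hjk.symm
  have hww : w = w' := C.eq_of_overlap fun i => by
    rcases eq_or_ne i j with rfl | hij
    · exact ⟨by linarith [hwj.1], by linarith [hnext_germ.1]⟩
    · rcases eq_or_ne i k with rfl | hik
      · exact hb.overlap hwk''
      · exact (hwi i hij).overlap (hwi' i hik)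
  subst hww
  linarith [hnext_germ.1]

/-- The smallest cube in a valley does not touch the walls of the valley from the left. -/
theorem Valley.lt_upper [DecidableEq ι] (hV : C.Valley o p q t) {c : K}
    (hc : C.StandsOn o p q t c)
    (hmin : ∀ w, C.StandsOn o p q t w → w ≠ c → C.s c < C.s w) {j k : ι} (hj : j ≠ o) (hk : k ≠ o)
    (hjk : k ≠ j) : C.a c j + C.s c < q j := by
  by_contra hcon
  have hcj : C.a c j + C.s c = q j := le_antisymm (hc.2 j hj).2.1 (not_lt.1 hcon)
  have hpos := C.pos c
  have hcj2 := hc.2 j hj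
  obtain ⟨w, hw, hwx⟩ := hV.exists_standsOn (x := C.a c)
    (d := Function.update (fun _ => true) j false) hc.1
    (by rw [Function.update_of_ne hj.symm]) (fun i hi => by
      have hci := hc.2 i hi
      rcases eq_or_ne i j with rfl | hij
      · rw [Function.update_self]
        exact germMem_false (by linarith) (by linarith)
      · rw [Function.update_of_ne hij]
        exact germMem_true hci.1 (by linarith))
  have hwj := hwx j
  rw [Function.update_self] at hwj
  have hwi : ∀ i, i ≠ j → GermMem (C.a w i) (C.a w i + C.s w) (C.a c i) true := fun i hi => by
    simpa [Function.update_of_ne hi] using hwx i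
  have hwc : w ≠ c := by
    rintro rfl
    exact absurd (hwj.2.2.2 rfl) (lt_irrefl _)
  have hlt := hmin w hw hwc
  have hwj' : C.a w j + C.s w ≤ C.a c j := by
    by_contra hlt'
    refine hwc (C.eq_of_overlap fun i => ?_)
    rcases eq_or_ne i j with rfl | hij
    · exact ⟨by linarith [hwj.2.2.2 rfl], not_le.1 hlt'⟩
    · exact (hwi i hij).overlap (germMem_true le_rfl (by linarith))
  have hwk := hwi k hjk
  have hwk' := hw.2 k hk
  obtain ⟨xk, b, hb, hPk, hck⟩ : ∃ xk b, GermMem (C.a w k) (C.a w k + C.s w) xk b ∧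
      GermMem (p k) (q k) xk b ∧ ¬ GermMem (C.a c k) (C.a c k + C.s c) xk b := by
    by_cases hup : C.a c k + C.s c < C.a w k + C.s w
    · have hg : GermMem (C.a w k) (C.a w k + C.s w) (C.a c k + C.s c) true :=
        germMem_true (by linarith [hwk.1]) hup
      exact ⟨_, true, hg, hg.mono hwk'.1 hwk'.2.1, fun h => lt_irrefl _ (h.2.2.1 rfl)⟩
    · have hg : GermMem (C.a w k) (C.a w k + C.s w) (C.a c k) false :=
        germMem_false (by linarith) hwk.2.1
      exact ⟨_, false, hg, hg.mono hwk'.1 hwk'.2.1, fun h => lt_irrefl _ (h.2.2.2 rfl)⟩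
  -- The same narrow slot, now at the upper wall, hence the germ pointing in the negative direction
  -- `j`.
  obtain ⟨w', hw', hwx'⟩ := hV.exists_standsOn (x := Function.update
      (Function.update (C.a c) j (C.a c j + C.s c)) k xk)
    (d := Function.update (Function.update (fun _ => true) j false) k b)
    (by rw [Function.update_of_ne hk.symm, Function.update_of_ne hj.symm, hc.1])
    (by rw [Function.update_of_ne hk.symm, Function.update_of_ne hj.symm]) (fun i hi => by
      have hci := hc.2 i hi
      rcases eq_or_ne i k with rfl | hik
      · simpa using hPk
      · rw [Function.update_of_ne hik, Function.update_of_ne hik]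
        rcases eq_or_ne i j with rfl | hij
        · rw [Function.update_self, Function.update_self]
          exact germMem_false (by linarith) hci.2.1
        · rw [Function.update_of_ne hij, Function.update_of_ne hij]
          exact germMem_true hci.1 (by linarith))
  have hwi' : ∀ i, i ≠ k → i ≠ j → GermMem (C.a w' i) (C.a w' i + C.s w') (C.a c i) true :=
    fun i hi hij => by
      simpa [Function.update_of_ne hi, Function.update_of_ne hij] using hwx' i
  have hwk'' : GermMem (C.a w' k) (C.a w' k + C.s w') xk b := by simpa using hwx' k
  have hnext_germ : GermMem (C.a w' j) (C.a w' j + C.s w') (C.a c j + C.s c) false := by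
    simpa [Function.update_of_ne hjk.symm] using hwx' j
  have hwc' : w' ≠ c := by
    rintro rfl
    exact hck hwk''
  have hlt' := hmin w' hw' hwc'
  have hnext_mem := hw'.2 j hj
  have hww : w = w' := C.eq_of_overlap fun i => by
    rcases eq_or_ne i j with rfl | hij
    · exact ⟨by linarith [hnext_germ.2.1], by linarith [hwj.2.1]⟩
    · rcases eq_or_ne i k with rfl | hik
      · exact hb.overlap hwk''
      · exact (hwi i hij).overlap (hwi' i hik hij)
  subst hww
  linarith [hnext_germ.2.1]

/-- The top of the smallest cube in a valley is a valley. -/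
theorem Valley.top [DecidableEq ι] (hV : C.Valley o p q t) {c : K} (hc : C.StandsOn o p q t c)
    (hmin : ∀ w, C.StandsOn o p q t w → w ≠ c → C.s c < C.s w)
    (hlow : ∀ j, j ≠ o → p j < C.a c j) (hup : ∀ j, j ≠ o → C.a c j + C.s c < q j)
    (hex : ∃ j, j ≠ o) :
    C.Valley o (C.a c) (fun j => C.a c j + C.s c) (t + C.s c) := by
  have hpos := C.pos c
  have ht := hV.height_nonneg
  refine ⟨by linarith, ?_, fun j _ => C.nonneg c j, fun j _ => C.le c j, fun j _ => by linarith, ?_⟩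
  · obtain ⟨j, hj⟩ := hex
    -- A larger neighbour of `c` on the same floor rises above `c` and still fits in the box.
    obtain ⟨w, hw, hwx⟩ := hV.exists_standsOn (x := Function.update (C.a c) j (C.a c j + C.s c))
      (d := fun _ => true) (by rw [Function.update_of_ne hj.symm, hc.1]) rfl (fun i hi => by
        have hci := hc.2 i hi
        rcases eq_or_ne i j with rfl | hij
        · rw [Function.update_self]
          exact germMem_true (by linarith) (hup i hj)
        · rw [Function.update_of_ne hij]
          exact germMem_true hci.1 (by linarith))
    have hwc : w ≠ c := by
      rintro rfl
      have := (hwx j).2.2.1 rfl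
      rw [Function.update_self] at this
      exact lt_irrefl _ this
    have h1 := hmin w hw hwc
    have h2 := C.le w o
    have h3 := hw.1
    linarith
  · intro u huo huo' hu
    have hne : u ≠ c := by
      rintro rfl
      have := hc.1
      linarith
    have huo : C.a u o = t + C.s c := by
      refine le_antisymm huo (not_lt.1 fun hlt => hne (C.eq_of_overlap fun i => ?_))
      rcases eq_or_ne i o with rfl | hi
      · have := hc.1
        constructor <;> linarith
      · exact hu i hi
    -- If `u` reached over the edge of `c`, the larger cube `w` standing on the floor there would
    -- rise into `u`; but `w` starts at height `t` and `u` above it.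
    have key : ∀ k, k ≠ o → ∀ xk b, GermMem (C.a u k) (C.a u k + C.s u) xk b →
        GermMem (p k) (q k) xk b → GermMem (C.a c k) (C.a c k + C.s c) xk b := by
      intro k hk xk b hb hPk
      by_contra hck
      obtain ⟨w, hw, hwx⟩ := hV.exists_standsOn
        (x := Function.update (Function.update (fun i => max (C.a c i) (C.a u i)) o t) k xk)
        (d := Function.update (fun _ => true) k b)
        (by rw [Function.update_of_ne hk.symm, Function.update_self])
        (by rw [Function.update_of_ne hk.symm]) (fun i hi => by
          have hci := hc.2 i hi
          rcases eq_or_ne i k with rfl | hik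
          · simpa using hPk
          · rw [Function.update_of_ne hik, Function.update_of_ne hik, Function.update_of_ne hi]
            exact germMem_true (hci.1.trans (le_max_left _ _))
              (max_lt (by linarith) (by linarith [(hu i hi).1])))
      have hwk : GermMem (C.a w k) (C.a w k + C.s w) xk b := by simpa using hwx k
      have hwc : w ≠ c := by
        rintro rfl
        exact hck hwk
      have hlt := hmin w hw hwc
      have hwo := hw.1
      have hwu : w = u := C.eq_of_overlap fun i => by
        rcases eq_or_ne i o with rfl | hi
        · have := C.pos u
          constructor <;> linarith
        · rcases eq_or_ne i k with rfl | hik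
          · exact hwk.overlap hb
          · have hwi := hwx i
            rw [Function.update_of_ne hik, Function.update_of_ne hik,
              Function.update_of_ne hi] at hwi
            exact hwi.overlap (germMem_true (le_max_right _ _)
              (max_lt (hu i hi).2 (by linarith [C.pos u])))
      subst hwu
      linarith
    have hle : ∀ k, k ≠ o → C.a c k ≤ C.a u k ∧ C.a u k + C.s u ≤ C.a c k + C.s c := by
      intro k hk
      have huk := hu k hk
      have h1 := hlow k hk
      have h2 := hup k hk
      constructor
      · by_contra hlt
        have := key k hk (C.a c k) false (germMem_false (not_le.1 hlt) huk.2.le)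
          (germMem_false h1 (by linarith))
        exact lt_irrefl _ (this.2.2.2 rfl)
      · by_contra hlt
        have := key k hk (C.a c k + C.s c) true (germMem_true huk.1.le (not_le.1 hlt))
          (germMem_true (by linarith) h2)
        exact lt_irrefl _ (this.2.2.1 rfl)
    refine ⟨huo, fun k hk => ⟨(hle k hk).1, (hle k hk).2, ?_⟩⟩
    have h1 := hle k hk
    refine lt_of_le_of_ne (by linarith) fun he => hne (C.injective (by linarith))

/-- A valley contains a cube whose top is again a valley. -/
theorem Valley.exists_top [Finite K] [DecidableEq ι] (hV : C.Valley o p q t)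
    (hdim : ∀ j, ∃ k, k ≠ o ∧ k ≠ j) :
    ∃ c, C.StandsOn o p q t c ∧
      C.Valley o (C.a c) (fun j => C.a c j + C.s c) (t + C.s c) := by
  obtain ⟨w₀, hw₀, -⟩ := hV.exists_standsOn (x := Function.update p o t) (d := fun _ => true)
    (by simp) rfl (fun j hj => by
      rw [Function.update_of_ne hj]
      exact germMem_true le_rfl (hV.lt j hj))
  obtain ⟨c, hc, hcmin⟩ := Set.exists_min_image {w | C.StandsOn o p q t w} C.s (Set.toFinite _)
    ⟨w₀, hw₀⟩
  have hmin : ∀ w, C.StandsOn o p q t w → w ≠ c → C.s c < C.s w := fun w hw hwc =>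
    lt_of_le_of_ne (hcmin w hw) fun he => hwc (C.injective he.symm)
  refine ⟨c, hc, hV.top hc hmin (fun j hj => ?_) (fun j hj => ?_) ?_⟩
  · obtain ⟨k, hk, hkj⟩ := hdim j
    exact hV.lower_lt hc hmin hj hk hkj
  · obtain ⟨k, hk, hkj⟩ := hdim j
    exact hV.lt_upper hc hmin hj hk hkj
  · obtain ⟨k, hk, -⟩ := hdim o
    exact ⟨k, hk⟩

/-- No box of dimension at least three has a tiling by cubes of pairwise different sizes, none
of which reaches from one face to the opposite one. -/
theorem false_of_lt [Finite K] [DecidableEq ι] (C : PerfectCubing ι K) (o : ι)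
    (hpos : ∀ i, 0 < C.h i) (hdim : ∀ j, ∃ k, k ≠ o ∧ k ≠ j) (hlt : ∀ v j, C.s v < C.h j) :
    False := by
  have hV : C.Valley o 0 C.h 0 :=
    { height_nonneg := le_rfl
      height_lt := hpos o
      lower_nonneg := fun _ _ => le_rfl
      upper_le := fun _ _ => le_rfl
      lt := fun j _ => hpos j
      standsOn := fun w hw _ _ => ⟨le_antisymm hw (C.nonneg w o), fun j _ =>
        ⟨C.nonneg w j, C.le w j, by simpa using hlt w j⟩⟩ }
  -- Infinite descent: a cube of `S` of least side carries on its top a strictly smaller cube of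
  -- `S`.
  let S : Set K := {c | C.Valley o (C.a c) (fun j => C.a c j + C.s c) (C.a c o + C.s c)}
  have hS : S.Nonempty := by
    obtain ⟨c, hc, hcV⟩ := hV.exists_top hdim
    exact ⟨c, by simpa only [S, Set.mem_ofPred_eq, hc.1] using hcV⟩
  obtain ⟨c, hcV, hcmin⟩ := Set.exists_min_image S C.s (Set.toFinite S) hS
  obtain ⟨c', hc', hcV'⟩ := Valley.exists_top hcV hdim
  have hmem : c' ∈ S := by simpa only [S, Set.mem_ofPred_eq, hc'.1] using hcV'
  obtain ⟨k, hk, -⟩ := hdim o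
  have h1 := hc'.2 k hk
  linarith [hcmin c' hmem]

end PerfectCubing

/-! ### From tilings to equal cubes, and the conclusion. -/

/-- No cube of a packing reaches from one face of the box to the opposite one. -/
theorem CubePacking.side_lt {V : Type*} [Finite V] {n : ℕ} {T : DiscreteBox V n}
    {h : Fin n → ℝ} (P : CubePacking T h) (hpos : ∀ i, 0 < h i) (v : T.Vertex) {j k : Fin n}
    (hkj : k ≠ j) : (P.side v : ℝ) < h j := by
  by_contra hcon
  have hv : (0 : ℝ) < P.side v := (hpos j).trans_le (not_lt.1 hcon)
  -- A line in direction `j` through the interior of a cube spanning the box meets no other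
  -- nondegenerate cube. Shifting it to a generic coordinate `c` in direction `k` also avoids the
  -- point cubes, so its path is the single vertex `v`, which would lie in both opposite faces.
  obtain ⟨c, hc, hcn⟩ : ∃ c ∈ Set.Ioo (P.corner v k) (P.corner v k + P.side v),
      c ∉ Set.range fun w => P.corner w k :=
    ((Set.Ioo_infinite (by linarith)).sdiff (Set.finite_range _)).nonempty
  let y : Fin n → ℝ := Function.update (fun i => P.corner v i + P.side v / 2) k c
  have hyv : ∀ i, P.corner v i < y i ∧ y i < P.corner v i + P.side v := by
    intro i
    rcases eq_or_ne i k with rfl | hi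
    · simpa [y] using hc
    · simp only [y, Function.update_of_ne hi]
      constructor <;> linarith
  have hy : y ∈ Set.Icc 0 h := ⟨fun i => (P.corner_nonneg v i).trans (hyv i).1.le,
    fun i => (hyv i).2.le.trans (P.corner_add_le v i)⟩
  obtain ⟨a, b, ha, hb, γ, hγ⟩ := P.exists_path_lineVertices j hy
  have hline : ∀ w ∈ P.lineVertices j y, w = v := by
    intro w hw
    by_contra hne
    have hws : 0 < P.side w := by
      refine pos_iff_ne_zero.2 fun h0 => hcn ⟨w, ?_⟩
      have hwk := hw k hkj
      rw [h0, NNReal.coe_zero, add_zero] at hwk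
      exact (le_antisymm hwk.1 hwk.2).trans (by simp [y])
    obtain ⟨i, hi⟩ := P.separated w v hne hws (NNReal.coe_pos.1 hv)
    have hws' : (0 : ℝ) < P.side w := NNReal.coe_pos.2 hws
    rcases eq_or_ne i j with rfl | hij
    · have h1 := P.corner_nonneg w i
      have h2 := P.corner_add_le w i
      have h3 := P.corner_nonneg v i
      have h4 := P.corner_add_le v i
      rcases hi with hi | hi <;> linarith
    · have h1 := hw i hij
      have h2 := hyv i
      rcases hi with hi | hi <;> linarith
  have hav := hline a (hγ a γ.1.start_mem_support)
  have hbv := hline b (hγ b γ.1.end_mem_support)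
  subst hav
  subst hbv
  exact T.notMem_B'_of_mem_B ha hb

/-- The nondegenerate cubes of a tiling contain one-sided neighbourhoods of every point. -/
theorem CubeTiling.exists_germMem {V : Type*} [Finite V] {n : ℕ} [NeZero n] {T : DiscreteBox V n}
    {h : Fin n → ℝ} (C : CubeTiling T h) (x : Fin n → ℝ) (d : Fin n → Bool)
    (hx : ∀ j, GermMem 0 (h j) (x j) (d j)) :
    ∃ w, 0 < C.side w ∧
      ∀ j, GermMem (C.corner w j) (C.corner w j + C.side w) (x j) (d j) := by
  let f : ℝ → Fin n → ℝ := fun ε j => if d j then x j + ε else x j - ε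
  have hlt : ∀ r : ℝ, 0 < r → ∀ᶠ ε in nhdsWithin (0 : ℝ) (Set.Ioi 0), 0 < ε ∧ ε < r :=
    fun r hr => Ioo_mem_nhdsGT hr
  have hev : ∀ᶠ ε in nhdsWithin (0 : ℝ) (Set.Ioi 0), f ε ∈ Set.Icc 0 h := by
    have hj : ∀ j, ∀ᶠ ε in nhdsWithin (0 : ℝ) (Set.Ioi 0), 0 ≤ f ε j ∧ f ε j ≤ h j := by
      intro j
      obtain ⟨h1, h2, h3, h4⟩ := hx j
      rcases hd : d j with _ | _
      · filter_upwards [hlt (x j) (h4 hd)] with ε hε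
        simp only [f, hd]
        constructor <;> simp <;> linarith
      · filter_upwards [hlt (h j - x j) (sub_pos.2 (h3 hd))] with ε hε
        simp only [f, hd, if_true]
        constructor <;> linarith
    filter_upwards [Filter.eventually_all.2 hj] with ε hε
    exact ⟨fun j => (hε j).1, fun j => (hε j).2⟩
  -- There are finitely many cubes, so one of them contains `f ε` for arbitrarily small `ε`. It
  -- contains two distinct such points, hence is nondegenerate.
  obtain ⟨w, hw⟩ : ∃ w, ∃ᶠ ε in nhdsWithin (0 : ℝ) (Set.Ioi 0),
      f ε ∈ axisCube (C.corner w) (C.side w) := by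
    by_contra hcon
    simp only [not_exists, Filter.not_frequently] at hcon
    obtain ⟨ε, hε, hε'⟩ := (hev.and (Filter.eventually_all.2 hcon)).exists
    rw [← C.cover, Set.mem_iUnion] at hε
    obtain ⟨w, hw⟩ := hε
    exact hε' w hw
  have hget : ∀ r : ℝ, 0 < r → ∃ ε, 0 < ε ∧ ε < r ∧
      ∀ j, C.corner w j ≤ f ε j ∧ f ε j ≤ C.corner w j + C.side w := by
    intro r hr
    obtain ⟨ε, hε, hε'⟩ := (hw.and_eventually (hlt r hr)).exists
    exact ⟨ε, hε'.1, hε'.2, fun j => ⟨hε.1 j, hε.2 j⟩⟩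
  refine ⟨w, ?_, fun j => ?_⟩
  · obtain ⟨ε₁, hε₁, -, h1⟩ := hget 1 one_pos
    obtain ⟨ε₂, hε₂, hε₂₁, h2⟩ := hget ε₁ hε₁
    have h1 := h1 0
    have h2 := h2 0
    rw [← NNReal.coe_pos]
    simp only [f] at h1 h2
    split_ifs at h1 h2 <;> linarith
  · rcases hd : d j with _ | _
    · refine germMem_false ?_ (not_lt.1 fun hlt' => ?_)
      · obtain ⟨ε, hε, -, h1⟩ := hget 1 one_pos
        have := (h1 j).1
        simp only [f, hd, Bool.false_eq_true, if_false] at this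
        linarith
      · obtain ⟨ε, hε, hε', h1⟩ := hget _ (sub_pos.2 hlt')
        have := (h1 j).2
        simp only [f, hd, Bool.false_eq_true, if_false] at this
        linarith
    · refine germMem_true (not_lt.1 fun hlt' => ?_) ?_
      · obtain ⟨ε, hε, hε', h1⟩ := hget _ (sub_pos.2 hlt')
        have := (h1 j).1
        simp only [f, hd, if_true] at this
        linarith
      · obtain ⟨ε, hε, -, h1⟩ := hget 1 one_pos
        have := (h1 j).2
        simp only [f, hd, if_true] at this
        linarith

/-- In dimension at least three two nondegenerate cubes of a tiling have the same size. -/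
theorem CubeTiling.exists_side_eq {V : Type*} [Finite V] {n : ℕ} {T : DiscreteBox V (n + 3)}
    {h : Fin (n + 3) → ℝ} (C : CubeTiling T h) (hpos : ∀ i, 0 < h i) :
    ∃ v w, v ≠ w ∧ C.side v = C.side w ∧ 0 < C.side v := by
  by_contra! hcon
  have hdim : ∀ o j : Fin (n + 3), ∃ k, k ≠ o ∧ k ≠ j := by
    intro o j
    obtain ⟨k, hk⟩ := Finset.exists_mem_notMem_of_card_lt_card
      (s := {o, j}) (t := (Finset.univ : Finset (Fin (n + 3))))
      (by rw [Finset.card_univ, Fintype.card_fin]; exact (Finset.card_le_two).trans_lt (by omega))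
    exact ⟨k, by simpa using hk.2⟩
  let Q : PerfectCubing (Fin (n + 3)) {v : T.Vertex // 0 < C.side v} :=
    { a := fun v => C.corner v.1
      s := fun v => C.side v.1
      h := h
      pos := fun v => NNReal.coe_pos.2 v.2
      nonneg := fun v => C.packing.corner_nonneg v.1
      le := fun v => C.packing.corner_add_le v.1
      separated := fun v w hvw =>
        C.packing.separated v.1 w.1 (fun he => hvw (Subtype.ext he)) v.2 w.2
      cover := fun x d hx => by
        obtain ⟨w, hw, hwx⟩ := C.exists_germMem x d hx
        exact ⟨⟨w, hw⟩, hwx⟩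
      injective := fun v w hvw => by
        by_contra hne
        have := hcon v.1 w.1 (fun he => hne (Subtype.ext he)) (NNReal.coe_injective hvw)
        exact absurd v.2 (not_lt.2 this) }
  refine Q.false_of_lt 0 hpos (hdim 0) fun v j => ?_
  obtain ⟨k, hk, -⟩ := hdim j j
  exact C.packing.side_lt hpos v.1 hk

theorem mainTheorem3 {V : Type*} [Finite V] (n : ℕ) (T : DiscreteBox V (n + 3))
    (m : T.Vertex → ℝ≥0) (hm : T.IsExtremal m)
    (h : Fin (n + 3) → ℝ) (hpos : ∀ i, 0 < h i) (hvol : ∏ i, h i = 1)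
    (C : CubeTiling T h) :
    (∀ (i : Fin (n + 3)) (τ : Equiv.Perm (Fin (n + 2))),
      ((T.face i).permute τ).EL = ((T.face' i).permute τ).EL) ∧
    (∀ σ : Fin (n + 3) → Equiv.Perm (Fin (n + 3)), (∀ i, σ i 0 = i) →
      ∏ i, (T.permute (σ i)).EL = 1) ∧
    (∃ v w : T.Vertex, v ≠ w ∧ m v = m w ∧ 0 < m v) := by
  refine ⟨fun i τ => ?_, fun σ hσ => ?_, ?_⟩
  · exact (((C.packing.face i).permute τ).EL_eq fun _ => hpos _).trans
      (((C.packing.face' i).permute τ).EL_eq fun _ => hpos _).symm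
  · have hEL : ∀ i, (T.permute (σ i)).EL = h i := by
      intro i
      have := (C.packing.permute (σ i)).EL_eq fun _ => hpos _
      rw [this, Equiv.prod_comp (σ i) h, hvol, Real.one_rpow, div_one]
      exact congrArg h (hσ i)
    simp only [hEL, hvol]
  · obtain ⟨v, w, hvw, hside, hv⟩ := C.exists_side_eq hpos
    obtain ⟨c, hc, hmc⟩ := C.packing.eq_of_isExtremal hpos hm
    refine ⟨v, w, hvw, NNReal.coe_injective ?_, NNReal.coe_pos.1 ?_⟩
    · rw [hmc, hmc]
      exact congrArg (fun r : ℝ≥0 => c * (r : ℝ)) hside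
    · rw [hmc]
      exact mul_pos hc (NNReal.coe_pos.2 hv)
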